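/- **Setting.** Let $d\in\{2,3\}$, let $\Omega\subset\mathbb R^d$ be a bounded polyhedral domain, and let $\Gamma_d\subset\partial\Omega$ be measurable with $0<|\Gamma_d|$ and $|\partial\Omega\setminus\Gamma_d|>0$ (surface measure). Write $\langle\cdot,\cdot\rangle$ for the $L^2(\Omega)$ inner product, $\|\cdot\|_m$ for the $H^m(\Omega)$ norm, $\varepsilon(\cdot)$ for the symmetric gradient, and set $V=H^1_{0,\Gamma_d}(\Omega;\mathbb R^d)$. Let $N$ be the number of networks. Let $\mu>0$, $\lambda>0$ with $\mu\le c_\lambda\lambda$, $0<s_i\le s_{\max}$, $\alpha_i\in(0,1]$; let $K_i(x)$ be measurable symmetric matrices with $K_i^-|z|^2\le z\cdot K_i(x)z\le K_i^+|z|^2$ for a.e. $x$ and all $z\in\mathbb R^d$, where $0<K_i^-\le K_i^+$; and let $\xi_{j\leftarrow i}=\xi_{i\leftarrow j}\ge 0$ be bounded measurable functions. Put $\alpha\cdot p=\sum_i\alpha_ip_i$ and $\xi_i(p)=\sum_{j}\xi_{j\leftarrow i}(p_i-p_j)$. **Exact solution.** Let $f\in C^0([0,T];L^2(\Omega;\mathbb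 R^d))$, $g_i\in C^0([0,T];L^2(\Omega))$. Let $u\in C^0([0,T];V)$, $p_t\in C^0([0,T];L^2(\Omega))\cap C^1((0,T];L^2(\Omega))$, $p_i\in C^0([0,T];H^1_0(\Omega))\cap C^1((0,T];H^1_0(\Omega))$ satisfy, for $t\in(0,T]$, $$\langle2\mu\varepsilon(u),\varepsilon(v)\rangle-\langle p_t,\operatorname{div}v\rangle=\langle f,v\rangle\quad\forall v\in V,$$ $$-\langle\operatorname{div}u,q\rangle-\langle\lambda^{-1}p_t,q\rangle+\langle\lambda^{-1}\alpha\cdot p,q\rangle=0\quad\forall q\in L^2(\Omega),$$ $$\langle s_i\dot p_i+\alpha_i\lambda^{-1}(-\dot p_t+\alpha\cdot\dot p)+\xi_i(p),q\rangle+\langle K_i\nabla p_i,\nabla q\rangle=\langle g_i,q\rangle\quad\forall q\in H^1_0(\Omega),\ 1\le i\le N,$$ with initial values $(u^0,p_t^0,p^0)\in V\times L^2(\Omega)\times H^1_0(\Omega)^N$ that are compatible, i.e. satisfy the first two equations at $t=0$. Assume that the solution is sufficiently regular: for integers $k_u,k_p\ge1$, the norms of $u$ in $L^\infty(0,T;H^{k_u+1})$,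 of $p_t$ in $L^\infty(0,T;H^{k_u})$, of $p_i$ in $L^\infty(0,T;H^{k_p+1})$ (suprema over all $t\in[0,T]$), and of the $C^3$ functions $p_t,p_i:[0,T]\to L^2(\Omega)$ in $W^{3,\infty}(0,T;L^2)$ are at most $M$. **Discretization.** Let $h>0$, $0<\Delta t\le T$, and let $V_h\subset V$, $Q_{t,h}\subset L^2(\Omega)$, $Q_{i,h}\subset L^2(\Omega)$ be finite dimensional. Put $\|v\|_V^2=\langle2\mu\varepsilon(v),\varepsilon(v)\rangle$, $\|q\|_{Q_t}^2=\langle(2\mu)^{-1}q,q\rangle$. Assume the inf-sup condition $\sup_{v\in V_h}\langle\operatorname{div}v,q\rangle/\|v\|_V\ge\beta\|q\|_{Q_t}$ for $q\in Q_{t,h}$, with $\beta>0$, and the approximation properties $\inf_{v\in V_h}\|w-v\|_V\le c_{a}h^{k_u}\|w\|_{k_u+1}$ for $w\in V\cap H^{k_u+1}$ and $\inf_{q\in Q_{t,h}}\|r-q\|_{Q_t}\le c_{a}h^{k_u}\|r\|_{k_u}$ for $r\in H^{k_u}(\Omega)$. For each $i$, let $a_{h,i}$ be a symmetric bilinear form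 and $|||\cdot|||_i$ a seminorm on a subspace $W_i\subset L^2(\Omega)$ containing $Q_{i,h}$, such that * (consistency) if $w\in H_0^1\cap H^{k_p+1}$ and $-\operatorname{div}(K_i\nabla w)=F\in L^2(\Omega)$ weakly, then $w\in W_i$ and $a_{h,i}(w,q)=\langle F,q\rangle$ for all $q\in Q_{i,h}$; * (boundedness, coercivity, discrete Poincaré inequality) $|a_{h,i}(w,q)|\le c_s|||w|||_i\,|||q|||_i$, $|||q|||_i^2\le c_s\,a_{h,i}(q,q)$ and $\|w\|\le c_s|||w|||_i$ for $w\in W_i$, $q\in Q_{i,h}$; * (approximation) $\inf_{q\in Q_{i,h}}|||w-q|||_i\le c_ah^{k_p}\|w\|_{k_p+1}$ for $w\in H^1_0\cap H^{k_p+1}\cap W_i$. (For a conforming Galerkin method $a_{h,i}(p,q)=\langle K_i\nabla p,\nabla q\rangle$ on $W_i=H^1_0(\Omega)$ and $|||q|||_i^2=a_{h,i}(q,q)$.) Put $S(p,q)=\sum_i\langle s_ip_i,q_i\rangle+\langle\lambda^{-1}\alpha\cdot p,\alpha\cdot q\rangle$ and $A(p,q)=\sum_i\big(\langle\xi_i(p),q_i\rangle+a_{h,i}(p_i,q_i)\big)$,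 with $\|p\|_S^2=S(p,p)$, $\|p\|_A^2=A(p,p)$. Define projections: $(\Pi u,\Pi p_t)\in V_h\times Q_{t,h}$ satisfies $\langle2\mu\varepsilon(\Pi u-u),\varepsilon(v)\rangle-\langle\Pi p_t-p_t,\operatorname{div}v\rangle=0$ and $\langle\operatorname{div}(\Pi u-u),q\rangle+\langle\lambda^{-1}(\Pi p_t-p_t),q\rangle=0$ for all $v\in V_h$, $q\in Q_{t,h}$; and $\Pi p\in\prod_iQ_{i,h}$ satisfies $A(\Pi p,q)=A(p,q)$ for all $q\in\prod_iQ_{i,h}$. **Scheme.** Write $\sigma^n=\sigma(n\Delta t)$ and $\sigma^{1/2}=(\sigma^0+\sigma^1)/2$. Let $(u_h^0,p_{t,h}^0,p_h^0)\in V_h\times Q_{t,h}\times\prod_iQ_{i,h}$ satisfy $p_h^0=\Pi p^0$ and $\|u^0-u^0_h\|_V+\|p_t^0-p_{t,h}^0\|_{Q_t}\le c_0h^{k_u}(\|u^0\|_{k_u+1}+\|p_t^0\|_{k_u})$. Let $(u_h^1,p_{t,h}^1,p_h^1)$ in the same space satisfy, for all $v\in V_h$, $q\in Q_{t,h}$,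 $q_i\in Q_{i,h}$, $1\le i\le N$, $$\langle2\mu\varepsilon(u_h^1),\varepsilon(v)\rangle-\langle p_{t,h}^1,\operatorname{div}v\rangle=\langle f^1,v\rangle,$$ $$-\langle\operatorname{div}u_h^1,q\rangle-\langle\lambda^{-1}p_{t,h}^1,q\rangle+\langle\lambda^{-1}\alpha\cdot p_h^1,q\rangle=0,$$ $$-\Big\langle s_i\tfrac{p_{i,h}^1-p_{i,h}^0}{\Delta t},q_i\Big\rangle-\Big\langle-\alpha_i\lambda^{-1}\tfrac{p_{t,h}^1-p_{t,h}^0}{\Delta t}+\alpha_i\lambda^{-1}\alpha\cdot\tfrac{p_h^1-p_h^0}{\Delta t}+\xi_i(p_h^{1/2}),q_i\Big\rangle-a_{h,i}(p_{i,h}^{1/2},q_i)=-\langle g_i^{1/2},q_i\rangle .$$ For $\sigma\in\{u,p_t,p\}$ let $e_\sigma^{h,n}=\Pi\sigma^n-\sigma_h^n$ and $D_\sigma^0=e_\sigma^{h,1}-e_\sigma^{h,0}$. **Theorem.** There is a constant $C>0$, depending only on $d,N,\Omega,\Gamma_d,\mu,\alpha,K,\xi,T,k_u,k_p$, on the constants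 $s_{\max},c_\lambda,\beta,c_a,c_s,c_0$ and on the bound $M$ for the norms of the exact solution (and therefore independent of $h$, of $\Delta t$, of the discrete spaces and forms, and uniform in $s_i\in(0,s_{\max}]$ and in $\lambda\ge\mu/c_\lambda$), such that in every such situation $$\|D_u^0\|_V^2+\|D_{p_t}^0\|_{Q_t}^2+\|D_p^0\|_S^2+\Delta t\,\|e_p^{h,1}\|_A^2\le C\big((\Delta t)^6+h^{2k_p}+h^{2k_u}\big),$$ $$\|e_u^{h,1}\|_V+\|e_{p_t}^{h,1}\|_{Q_t}+\|e_p^{h,1}\|_S\le C\big((\Delta t)^3+h^{k_p}+h^{k_u}\big).$$ -/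

import Mathlib

open MeasureTheory Set Filter Topology
open scoped ENNReal ContDiff

noncomputable section

namespace MPET

/-! ### Lebesgue and Sobolev spaces -/

/-- Points of `ℝ^d` with the Euclidean norm. -/
abbrev Pt (d : ℕ) := EuclideanSpace ℝ (Fin d)

/-- The `j`-th coordinate vector. -/
def e {d : ℕ} (j : Fin d) : Pt d := EuclideanSpace.single j (1 : ℝ)

/-- `L²(Ω)`, real valued, with its Hilbert space structure. -/
abbrev L2 {d : ℕ} (Ω : Set (Pt d)) := Lp ℝ 2 (volume.restrict Ω)

/-- Test functions `C_c^∞(Ω)`. -/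
structure IsTest {d : ℕ} (Ω : Set (Pt d)) (φ : Pt d → ℝ) : Prop where
  smooth : ContDiff ℝ ∞ φ
  compact : HasCompactSupport φ
  supp : tsupport φ ⊆ Ω

/-- The classical mixed derivative `∂_{β 0} ⋯ ∂_{β (m-1)} φ`. -/
def mixedPartial {d m : ℕ} (β : Fin m → Fin d) (φ : Pt d → ℝ) (x : Pt d) : ℝ :=
  iteratedFDeriv ℝ m φ x (fun k => e (β k))

/-- `g` is the weak derivative `∂_{β 0} ⋯ ∂_{β (m-1)} u` on `Ω`. -/
def HasWeakPartial {d m : ℕ} {Ω : Set (Pt d)} (β : Fin m → Fin d) (u g : L2 Ω) : Prop :=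
  ∀ φ : Pt d → ℝ, IsTest Ω φ →
    ∫ x in Ω, u x * mixedPartial β φ x = (-1 : ℝ) ^ m * ∫ x in Ω, g x * φ x

/-- Membership in `H^m(Ω)`. -/
def MemHm {d : ℕ} {Ω : Set (Pt d)} (m : ℕ) (u : L2 Ω) : Prop :=
  ∀ j ≤ m, ∀ β : Fin j → Fin d, ∃ g : L2 Ω, HasWeakPartial β u g

open Classical in
/-- The weak derivative, if it exists in `L²(Ω)` (it is then unique). -/
def weakPartial {d m : ℕ} {Ω : Set (Pt d)} (β : Fin m → Fin d) (u : L2 Ω) : L2 Ω :=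
  if h : ∃ g : L2 Ω, HasWeakPartial β u g then h.choose else 0

/-- The norm `‖u‖_m` of `H^m(Ω)`: the square root of `∑_{j ≤ m} ‖D^j u‖²`. -/
def hmNorm {d : ℕ} {Ω : Set (Pt d)} (m : ℕ) (u : L2 Ω) : ℝ :=
  Real.sqrt (∑ j ∈ Finset.range (m + 1), ∑ β : Fin j → Fin d, ‖weakPartial β u‖ ^ 2)

lemma mixedPartial_memLp {d m : ℕ} {Ω : Set (Pt d)} (β : Fin m → Fin d) {φ : Pt d → ℝ}
    (hφ : IsTest Ω φ) : MemLp (mixedPartial β φ) 2 (volume.restrict Ω) := by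
  have hc : Continuous (mixedPartial β φ) := by
    have h := hφ.smooth.continuous_iteratedFDeriv (m := m) (by exact_mod_cast le_top)
    unfold mixedPartial
    fun_prop
  have hs : HasCompactSupport (mixedPartial β φ) := by
    have h := hφ.compact.iteratedFDeriv (𝕜 := ℝ) m
    refine h.mono' ?_
    intro x hx
    refine subset_tsupport _ ?_
    intro h0
    apply hx
    simp [mixedPartial, h0]
  exact hc.memLp_of_hasCompactSupport hs

lemma test_memLp {d : ℕ} {Ω : Set (Pt d)} {φ : Pt d → ℝ}
    (hφ : IsTest Ω φ) : MemLp φ 2 (volume.restrict Ω) :=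
  hφ.smooth.continuous.memLp_of_hasCompactSupport hφ.compact

lemma integral_add_mul {d : ℕ} {Ω : Set (Pt d)} (u v : L2 Ω) {ψ : Pt d → ℝ}
    (hψ : MemLp ψ 2 (volume.restrict Ω)) :
    ∫ x in Ω, (u + v : L2 Ω) x * ψ x = (∫ x in Ω, u x * ψ x) + ∫ x in Ω, v x * ψ x := by
  have hu : Integrable (fun x => u x * ψ x) (volume.restrict Ω) := (Lp.memLp u).integrable_mul hψ
  have hv : Integrable (fun x => v x * ψ x) (volume.restrict Ω) := (Lp.memLp v).integrable_mul hψ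
  rw [← integral_add hu hv]
  refine integral_congr_ae ?_
  filter_upwards [Lp.coeFn_add u v] with x hx
  rw [hx]; simp [add_mul]

lemma integral_smul_mul {d : ℕ} {Ω : Set (Pt d)} (c : ℝ) (u : L2 Ω) (ψ : Pt d → ℝ) :
    ∫ x in Ω, (c • u : L2 Ω) x * ψ x = c * ∫ x in Ω, u x * ψ x := by
  rw [← integral_const_mul]
  refine integral_congr_ae ?_
  filter_upwards [Lp.coeFn_smul c u] with x hx
  rw [hx]; simp [mul_assoc]

lemma integral_zero_mul' {d : ℕ} {Ω : Set (Pt d)} (ψ : Pt d → ℝ) :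
    ∫ x in Ω, (0 : L2 Ω) x * ψ x = 0 := by
  have h := integral_smul_mul (Ω := Ω) 0 0 ψ
  simpa using h

/-- `H¹(Ω)`, realised as the space of pairs `(v, ∇v)` of an `L²` function and its weak gradient.
It carries the (product) topology of `L²`-convergence of the function and of its gradient. -/
def H1 {d : ℕ} (Ω : Set (Pt d)) : Submodule ℝ (L2 Ω × (Fin d → L2 Ω)) where
  carrier := {v | ∀ j : Fin d, HasWeakPartial (fun _ : Fin 1 => j) v.1 (v.2 j)}
  zero_mem' := by
    intro j φ _
    simp only [Prod.fst_zero, Prod.snd_zero, Pi.zero_apply]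
    rw [integral_zero_mul', integral_zero_mul', mul_zero]
  add_mem' := by
    intro u v hu hv j φ hφ
    simp only [Prod.fst_add, Prod.snd_add, Pi.add_apply]
    rw [integral_add_mul _ _ (mixedPartial_memLp _ hφ), integral_add_mul _ _ (test_memLp hφ),
      hu j φ hφ, hv j φ hφ, mul_add]
  smul_mem' := by
    intro c u hu j φ hφ
    simp only [Prod.smul_fst, Prod.smul_snd, Pi.smul_apply]
    rw [integral_smul_mul, integral_smul_mul, hu j φ hφ]
    ring

/-- The `L²` function underlying an element of `H¹(Ω)`. -/
def fn {d : ℕ} {Ω : Set (Pt d)} (v : H1 Ω) : L2 Ω := v.1.1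

/-- The weak partial derivative `∂_j v` of an element of `H¹(Ω)`. -/
def grad {d : ℕ} {Ω : Set (Pt d)} (v : H1 Ω) (j : Fin d) : L2 Ω := v.1.2 j

/-- The trace of `v ∈ H¹(Ω)` vanishes on `Γ ⊆ ∂Ω`: up to any `ε > 0`, `v` is the limit in `H¹(Ω)`
of functions that are smooth up to the boundary and whose restrictions to `Γ` tend to zero in
`L²(Γ)`, for the `(d-1)`-dimensional surface measure. -/
def HasZeroTrace {d : ℕ} {Ω : Set (Pt d)} (Γ : Set (Pt d)) (v : H1 Ω) : Prop :=
  ∀ ε : ℝ≥0∞, 0 < ε → ∃ φ : Pt d → ℝ, ContDiff ℝ ∞ φ ∧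
    eLpNorm (fun x => φ x - fn v x) 2 (volume.restrict Ω) ≤ ε ∧
    (∀ j, eLpNorm (fun x => fderiv ℝ φ x (e j) - grad v j x) 2 (volume.restrict Ω) ≤ ε) ∧
    eLpNorm φ 2 ((Measure.hausdorffMeasure ((d : ℝ) - 1)).restrict Γ) ≤ ε

lemma eLpNorm_sub_add_le {d : ℕ} {Ω : Set (Pt d)} {φ ψ : Pt d → ℝ} (hφ : Continuous φ)
    (hψ : Continuous ψ) (u v : L2 Ω) {ε : ℝ≥0∞}
    (h1 : eLpNorm (fun x => φ x - u x) 2 (volume.restrict Ω) ≤ ε / 2)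
    (h2 : eLpNorm (fun x => ψ x - v x) 2 (volume.restrict Ω) ≤ ε / 2) :
    eLpNorm (fun x => (φ x + ψ x) - (u + v : L2 Ω) x) 2 (volume.restrict Ω) ≤ ε := by
  have hE : (fun x => (φ x + ψ x) - (u + v : L2 Ω) x) =ᵐ[volume.restrict Ω]
      (fun x => φ x - u x) + (fun x => ψ x - v x) := by
    filter_upwards [Lp.coeFn_add u v] with x hx
    rw [hx]; simp; ring
  rw [eLpNorm_congr_ae hE]
  refine (eLpNorm_add_le (hφ.aestronglyMeasurable.sub (Lp.aestronglyMeasurable u))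
    (hψ.aestronglyMeasurable.sub (Lp.aestronglyMeasurable v)) (by norm_num)).trans ?_
  calc _ ≤ ε / 2 + ε / 2 := add_le_add h1 h2
    _ = ε := ENNReal.add_halves ε

lemma eLpNorm_sub_smul_le {d : ℕ} {Ω : Set (Pt d)} {φ : Pt d → ℝ} (c : ℝ) (u : L2 Ω) {ε : ℝ≥0∞}
    (h : eLpNorm (fun x => φ x - u x) 2 (volume.restrict Ω) ≤ ε / ‖c‖ₑ) :
    eLpNorm (fun x => c * φ x - (c • u : L2 Ω) x) 2 (volume.restrict Ω) ≤ ε := by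
  have hE : (fun x => c * φ x - (c • u : L2 Ω) x) =ᵐ[volume.restrict Ω]
      c • (fun x => φ x - u x) := by
    filter_upwards [Lp.coeFn_smul c u] with x hx
    rw [hx]; simp; ring
  rw [eLpNorm_congr_ae hE, eLpNorm_const_smul]
  calc _ ≤ ‖c‖ₑ * (ε / ‖c‖ₑ) := by gcongr
    _ ≤ ε := ENNReal.mul_div_le

lemma HasZeroTrace.smul {d : ℕ} {Ω Γ : Set (Pt d)} {u : H1 Ω} (hu : HasZeroTrace Γ u) (c : ℝ) :
    HasZeroTrace Γ (c • u) := by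
  intro ε hε
  have f1 : fn (c • u) = c • fn u := rfl
  have f2 : ∀ j, grad (c • u) j = c • grad u j := fun _ => rfl
  obtain ⟨φ, hφ, a1, a2, a3⟩ := hu (ε / ‖c‖ₑ) (ENNReal.div_pos hε.ne' (by simp))
  have dφ : Differentiable ℝ φ := hφ.differentiable (by simp)
  refine ⟨fun x => c * φ x, contDiff_const.mul hφ, ?_, fun j => ?_, ?_⟩
  · rw [f1]
    exact eLpNorm_sub_smul_le c (fn u) a1
  · have hd : ∀ x, fderiv ℝ (fun x => c * φ x) x (e j) = c * fderiv ℝ φ x (e j) := by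
      intro x
      rw [fderiv_const_mul (dφ x)]
      rfl
    simp only [hd, f2]
    exact eLpNorm_sub_smul_le c (grad u j) (a2 j)
  · have : (fun x => c * φ x) = c • φ := rfl
    rw [this, eLpNorm_const_smul]
    calc _ ≤ ‖c‖ₑ * (ε / ‖c‖ₑ) := by gcongr
      _ ≤ ε := ENNReal.mul_div_le

/-- `H¹_{0,Γ}(Ω)`. In particular `H¹_0(Ω)` is `H1zero Ω (frontier Ω)`. -/
def H1zero {d : ℕ} (Ω : Set (Pt d)) (Γ : Set (Pt d)) : Submodule ℝ (H1 Ω) where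
  carrier := {v | HasZeroTrace Γ v}
  zero_mem' := by
    intro ε _
    have h0 : ((0 : L2 Ω) : Pt d → ℝ) =ᵐ[volume.restrict Ω] 0 := Lp.coeFn_zero _ _ _
    have h1 : eLpNorm (fun x => -(0 : L2 Ω) x) 2 (volume.restrict Ω) = 0 := by
      rw [eLpNorm_congr_ae (g := 0) (by
        filter_upwards [h0] with x hx
        rw [hx]
        simp)]
      simp
    refine ⟨fun _ => 0, contDiff_const, ?_, fun j => ?_, by simp⟩
    · simp only [fn, zero_sub]
      exact h1.le.trans (zero_le)
    · simp only [grad, fderiv_fun_const, zero_sub]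
      refine le_trans (le_of_eq ?_) (zero_le)
      simpa using h1
  add_mem' := by
    intro u v hu hv ε hε
    obtain ⟨φ, hφ, a1, a2, a3⟩ := hu (ε / 2) (ENNReal.half_pos hε.ne')
    obtain ⟨ψ, hψ, b1, b2, b3⟩ := hv (ε / 2) (ENNReal.half_pos hε.ne')
    have dφ : Differentiable ℝ φ := hφ.differentiable (by simp)
    have dψ : Differentiable ℝ ψ := hψ.differentiable (by simp)
    have cφ := hφ.continuous_fderiv (by simp)
    have cψ := hψ.continuous_fderiv (by simp)
    refine ⟨fun x => φ x + ψ x, hφ.add hψ,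
      eLpNorm_sub_add_le hφ.continuous hψ.continuous (fn u) (fn v) a1 b1, fun j => ?_, ?_⟩
    · have h := eLpNorm_sub_add_le (φ := fun x => fderiv ℝ φ x (e j))
        (ψ := fun x => fderiv ℝ ψ x (e j)) (by fun_prop) (by fun_prop) (grad u j) (grad v j)
        (a2 j) (b2 j)
      refine le_of_eq_of_le ?_ h
      congr 1
      funext x
      rw [fderiv_fun_add (dφ x) (dψ x)]
      rfl
    · refine (eLpNorm_add_le hφ.continuous.aestronglyMeasurable
        hψ.continuous.aestronglyMeasurable (by norm_num)).trans ?_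
      calc _ ≤ ε / 2 + ε / 2 := add_le_add a3 b3
        _ = ε := ENNReal.add_halves ε
  smul_mem' := fun c _ hu => hu.smul c

/-- `V = H¹_{0,Γ_d}(Ω; ℝ^d)`. -/
def V {d : ℕ} (Ω Γd : Set (Pt d)) : Submodule ℝ (Fin d → H1 Ω) :=
  Submodule.pi Set.univ (fun _ => H1zero Ω Γd)

/-- The `H^m` norm of a vector field. -/
def vecHmNorm {d : ℕ} {Ω : Set (Pt d)} (m : ℕ) (u : Fin d → L2 Ω) : ℝ :=
  Real.sqrt (∑ i, hmNorm m (u i) ^ 2)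

/-- A polyhedral domain: open, connected, equal to the interior of its closure, with a closure
that is a finite union of nondegenerate closed `d`-simplices (hence bounded). -/
structure IsPolyhedralDomain {d : ℕ} (Ω : Set (Pt d)) : Prop where
  isOpen : IsOpen Ω
  isConnected : IsConnected Ω
  interior_closure : interior (closure Ω) = Ω
  triangulated : ∃ F : Set (Affine.Simplex ℝ (Pt d) d), F.Finite ∧
    closure Ω = ⋃ σ ∈ F, convexHull ℝ (Set.range σ.points)

/-! ### The medium: every datum other than the storage coefficients and `λ` -/

/-- `K i x` is the conductivity tensor of network `i` at `x`, and `ξ j i x` is `ξ_{j ← i}(x)`. -/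
structure Medium (d N : ℕ) where
  Ω : Set (Pt d)
  Γd : Set (Pt d)
  μ : ℝ
  α : Fin N → ℝ
  K : Fin N → Pt d → Matrix (Fin d) (Fin d) ℝ
  ξ : Fin N → Fin N → Pt d → ℝ

/-- The standing assumptions on domain, Dirichlet boundary and coefficients. -/
structure Medium.Admissible {d N : ℕ} (m : Medium d N) : Prop where
  dim : d = 2 ∨ d = 3
  domain : IsPolyhedralDomain m.Ω
  Γd_subset : m.Γd ⊆ frontier m.Ω
  Γd_meas : MeasurableSet m.Γd
  Γd_pos : 0 < Measure.hausdorffMeasure ((d : ℝ) - 1) m.Γd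
  Γt_pos : 0 < Measure.hausdorffMeasure ((d : ℝ) - 1) (frontier m.Ω \ m.Γd)
  μ_pos : 0 < m.μ
  α_mem : ∀ i, m.α i ∈ Ioc (0 : ℝ) 1
  K_meas : ∀ i j k, AEMeasurable (fun x => m.K i x j k) (volume.restrict m.Ω)
  K_symm : ∀ i, ∀ᵐ x ∂(volume.restrict m.Ω), (m.K i x).IsSymm
  K_elliptic : ∀ i, ∃ Klo Khi : ℝ, 0 < Klo ∧ 0 < Khi ∧ ∀ᵐ x ∂(volume.restrict m.Ω),
    ∀ v : Fin d → ℝ, Klo * ∑ j, v j ^ 2 ≤ dotProduct v ((m.K i x).mulVec v) ∧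
      dotProduct v ((m.K i x).mulVec v) ≤ Khi * ∑ j, v j ^ 2
  ξ_meas : ∀ j i, AEMeasurable (m.ξ j i) (volume.restrict m.Ω)
  ξ_nonneg : ∀ j i, ∀ᵐ x ∂(volume.restrict m.Ω), 0 ≤ m.ξ j i x
  ξ_symm : ∀ j i, ∀ᵐ x ∂(volume.restrict m.Ω), m.ξ j i x = m.ξ i j x
  ξ_bdd : ∃ B : ℝ, ∀ j i, ∀ᵐ x ∂(volume.restrict m.Ω), m.ξ j i x ≤ B

/-! ### Bilinear forms and norms -/

section forms

variable {d N : ℕ} {Ω : Set (Pt d)}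

/-- The `(i, j)` entry of `ε(u)`. -/
def strain (u : Fin d → H1 Ω) (i j : Fin d) : L2 Ω :=
  (1 / 2 : ℝ) • (grad (u i) j + grad (u j) i)

/-- `div u`. -/
def divg (u : Fin d → H1 Ω) : L2 Ω := ∑ i, grad (u i) i

/-- `⟨2 μ ε(u), ε(v)⟩`. -/
def elasticForm (μ : ℝ) (u v : Fin d → H1 Ω) : ℝ :=
  2 * μ * ∑ i, ∑ j, inner ℝ (strain u i j) (strain v i j)

/-- `‖v‖_V`. -/
def vNorm (μ : ℝ) (v : Fin d → H1 Ω) : ℝ := Real.sqrt (elasticForm μ v v)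

/-- `‖q‖_{Q_t}`. -/
def qtNorm (μ : ℝ) (q : L2 Ω) : ℝ := Real.sqrt ((2 * μ)⁻¹ * inner ℝ q q)

/-- `α · p`. -/
def dotα (α : Fin N → ℝ) (p : Fin N → L2 Ω) : L2 Ω := ∑ i, α i • p i

/-- `⟨ξ_i(p), q⟩`, where `ξ_i(p) = ∑_j ξ_{j ← i} (p_i - p_j)`. -/
def transferForm (ξ : Fin N → Fin N → Pt d → ℝ) (i : Fin N) (p : Fin N → L2 Ω) (q : L2 Ω) : ℝ :=
  ∫ x in Ω, (∑ j, ξ j i x * (p i x - p j x)) * q x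

/-- `⟨K ∇w, ∇q⟩`. -/
def diffusionForm (K : Pt d → Matrix (Fin d) (Fin d) ℝ) (w q : H1 Ω) : ℝ :=
  ∫ x in Ω, ∑ j, (∑ k, K x j k * grad w k x) * grad q j x

/-- `S(p, q)`. -/
def sForm (s α : Fin N → ℝ) (lam : ℝ) (p q : Fin N → L2 Ω) : ℝ :=
  (∑ i, s i * inner ℝ (p i) (q i)) + lam⁻¹ * inner ℝ (dotα α p) (dotα α q)

/-- `‖p‖_S`. -/
def sNorm (s α : Fin N → ℝ) (lam : ℝ) (p : Fin N → L2 Ω) : ℝ := Real.sqrt (sForm s α lam p p)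

end forms

/-! ### The continuous problem -/

section continuous

variable {d N : ℕ}

/-- The elasticity equation and the total pressure equation, in weak form, at one instant. -/
def SolvesStokes (m : Medium d N) (lam : ℝ) (f : Fin d → L2 m.Ω)
    (u : Fin d → H1 m.Ω) (pt : L2 m.Ω) (p : Fin N → L2 m.Ω) : Prop :=
  (∀ v ∈ V m.Ω m.Γd,
    elasticForm m.μ u v - inner ℝ pt (divg v) = ∑ i, inner ℝ (f i) (fn (v i))) ∧
  (∀ q : L2 m.Ω,
    -inner ℝ (divg u) q - lam⁻¹ * inner ℝ pt q + lam⁻¹ * inner ℝ (dotα m.α p) q = 0)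

/-- Compatible initial data, `f0` being the body force at time `0`. -/
structure IsCompatible (m : Medium d N) (lam : ℝ) (f0 : Fin d → L2 m.Ω)
    (u0 : Fin d → H1 m.Ω) (pt0 : L2 m.Ω) (p0 : Fin N → H1 m.Ω) : Prop where
  u_mem : u0 ∈ V m.Ω m.Γd
  p_mem : ∀ i, p0 i ∈ H1zero m.Ω (frontier m.Ω)
  stokes : SolvesStokes m lam f0 u0 pt0 (fun i => fn (p0 i))

/-- The time derivative, in `L²(Ω)`, of a function on `[0, T]`. -/
def dt {Ω : Set (Pt d)} (T : ℝ) (q : ℝ → L2 Ω) (t : ℝ) : L2 Ω := derivWithin q (Icc 0 T) t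

/-- `(u, pt, p)` solves the total pressure formulation on `[0, T]` with the given initial data. -/
structure IsSolution (m : Medium d N) (s : Fin N → ℝ) (lam T : ℝ)
    (f : ℝ → Fin d → L2 m.Ω) (g : ℝ → Fin N → L2 m.Ω)
    (u0 : Fin d → H1 m.Ω) (pt0 : L2 m.Ω) (p0 : Fin N → H1 m.Ω)
    (u : ℝ → Fin d → H1 m.Ω) (pt : ℝ → L2 m.Ω) (p : ℝ → Fin N → H1 m.Ω) : Prop where
  u_mem : ∀ t ∈ Icc 0 T, u t ∈ V m.Ω m.Γd
  p_mem : ∀ t ∈ Icc 0 T, ∀ i, p t i ∈ H1zero m.Ω (frontier m.Ω)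
  u_cont : ContinuousOn u (Icc 0 T)
  pt_cont : ContinuousOn pt (Icc 0 T)
  p_cont : ContinuousOn p (Icc 0 T)
  pt_diff : ContDiffOn ℝ 1 pt (Ioc 0 T)
  p_diff : ContDiffOn ℝ 1 p (Ioc 0 T)
  stokes : ∀ t ∈ Ioc 0 T, SolvesStokes m lam (f t) (u t) (pt t) (fun i => fn (p t i))
  diffusion : ∀ t ∈ Ioc 0 T, ∀ i, ∀ q ∈ H1zero m.Ω (frontier m.Ω),
    inner ℝ (s i • dt T (fun τ => fn (p τ i)) t
        + (m.α i * lam⁻¹) • (-dt T pt t + dotα m.α (fun k => dt T (fun τ => fn (p τ k)) t)))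
        (fn q)
      + transferForm m.ξ i (fun k => fn (p t k)) (fn q)
      + diffusionForm (m.K i) (p t i) q = inner ℝ (g t i) (fn q)
  u_init : u 0 = u0
  pt_init : pt 0 = pt0
  p_init : p 0 = p0

/-- Sufficient regularity of the exact solution, with all the norms involved bounded by `M`:
the norms of `u` in `L^∞(0,T; H^{ku+1})`, of `pt` in `L^∞(0,T; H^{ku})`, of each `p_i` in
`L^∞(0,T; H^{kp+1})`, and of `pt` and each `p_i` in `W^{3,∞}(0,T; L²)`. -/
structure IsRegular {Ω : Set (Pt d)} (ku kp : ℕ) (T M : ℝ)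
    (u : ℝ → Fin d → H1 Ω) (pt : ℝ → L2 Ω) (p : ℝ → Fin N → H1 Ω) : Prop where
  u_mem : ∀ t ∈ Icc 0 T, ∀ i, MemHm (ku + 1) (fn (u t i))
  u_le : ∀ t ∈ Icc 0 T, vecHmNorm (ku + 1) (fun i => fn (u t i)) ≤ M
  pt_mem : ∀ t ∈ Icc 0 T, MemHm ku (pt t)
  pt_le : ∀ t ∈ Icc 0 T, hmNorm ku (pt t) ≤ M
  p_mem : ∀ t ∈ Icc 0 T, ∀ i, MemHm (kp + 1) (fn (p t i))
  p_le : ∀ t ∈ Icc 0 T, ∀ i, hmNorm (kp + 1) (fn (p t i)) ≤ M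
  pt_smooth : ContDiffOn ℝ 3 pt (Icc 0 T)
  pt_deriv_le : ∀ j ≤ 3, ∀ t ∈ Icc 0 T, ‖iteratedDerivWithin j pt (Icc 0 T) t‖ ≤ M
  p_smooth : ∀ i, ContDiffOn ℝ 3 (fun t => fn (p t i)) (Icc 0 T)
  p_deriv_le : ∀ i, ∀ j ≤ 3, ∀ t ∈ Icc 0 T,
    ‖iteratedDerivWithin j (fun τ => fn (p τ i)) (Icc 0 T) t‖ ≤ M

end continuous

/-! ### The discretisation -/

/-- A symmetric primal discretisation of the Poisson operator in one network: the discrete space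
`Qh`, the discrete bilinear form `a`, and a mesh dependent energy norm. The form and the norm live
on a space `W` that contains `Qh` and (see `PressureMethod.Admissible`) the regular exact
pressures; their values off `W` are irrelevant. `Qh` need not be contained in `H¹(Ω)`, so that
nonconforming methods are allowed. For a conforming method `Qh ⊆ W = H¹_0(Ω)`,
`a(p, q) = ⟨K ∇p, ∇q⟩` and `energy q = a(q, q)^{1/2}`; for an interior penalty or enriched
Galerkin method `energy` is the usual mesh dependent norm, equivalent to `a(q, q)^{1/2}` on `Qh`. -/
structure PressureMethod {d : ℕ} (Ω : Set (Pt d)) where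
  W : Submodule ℝ (L2 Ω)
  Qh : Submodule ℝ (L2 Ω)
  a : L2 Ω → L2 Ω → ℝ
  energy : L2 Ω → ℝ
  Qh_le : Qh ≤ W
  finite : FiniteDimensional ℝ Qh
  a_add : ∀ u ∈ W, ∀ v ∈ W, ∀ w ∈ W, a (u + v) w = a u w + a v w
  a_smul : ∀ c : ℝ, ∀ u ∈ W, ∀ w ∈ W, a (c • u) w = c * a u w
  a_symm : ∀ u ∈ W, ∀ w ∈ W, a u w = a w u
  energy_nonneg : ∀ u ∈ W, 0 ≤ energy u
  energy_add : ∀ u ∈ W, ∀ v ∈ W, energy (u + v) ≤ energy u + energy v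
  energy_smul : ∀ c : ℝ, ∀ u ∈ W, energy (c • u) = |c| * energy u

/-- What makes `D` a method of order `k` for `⟨K ∇p, ∇q⟩` at mesh size `h`. -/
structure PressureMethod.Admissible {d : ℕ} {Ω : Set (Pt d)} (D : PressureMethod Ω)
    (K : Pt d → Matrix (Fin d) (Fin d) ℝ) (k : ℕ) (cStab cApp h : ℝ) : Prop where
  /-- consistency: if `w ∈ H¹_0 ∩ H^{k+1}` and `-div (K ∇w) = F ∈ L²`, then `w` satisfies the
  discrete equations -/
  consistent : ∀ w ∈ H1zero Ω (frontier Ω), MemHm (k + 1) (fn w) → ∀ F : L2 Ω,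
    (∀ q ∈ H1zero Ω (frontier Ω), diffusionForm K w q = inner ℝ F (fn q)) →
    fn w ∈ D.W ∧ ∀ q ∈ D.Qh, D.a (fn w) q = inner ℝ F q
  /-- boundedness -/
  bounded : ∀ w ∈ D.W, ∀ q ∈ D.Qh, |D.a w q| ≤ cStab * D.energy w * D.energy q
  /-- coercivity on the discrete space -/
  coercive : ∀ q ∈ D.Qh, D.energy q ^ 2 ≤ cStab * D.a q q
  /-- discrete Poincaré inequality -/
  poincare : ∀ w ∈ D.W, ‖w‖ ≤ cStab * D.energy w
  /-- approximation -/
  approx : ∀ w ∈ H1zero Ω (frontier Ω), MemHm (k + 1) (fn w) → fn w ∈ D.W →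
    ⨅ q : D.Qh, D.energy (fn w - q.1) ≤ cApp * h ^ k * hmNorm (k + 1) (fn w)

/-- The discrete spaces `V_h`, `Q_{t,h}` and the discretisations for the `N` networks. -/
structure Discretization {d N : ℕ} (m : Medium d N) where
  Vh : Submodule ℝ (Fin d → H1 m.Ω)
  Qth : Submodule ℝ (L2 m.Ω)
  net : Fin N → PressureMethod m.Ω

/-- The assumptions on the discretisation, with mesh size `h`, orders `ku`, `kp`, inf-sup constant
`β`, and constants `cStab`, `cApp` in the other bounds. -/
structure Discretization.Admissible {d N : ℕ} {m : Medium d N} (D : Discretization m)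
    (ku kp : ℕ) (β cStab cApp h : ℝ) : Prop where
  Vh_le : D.Vh ≤ V m.Ω m.Γd
  Vh_finite : FiniteDimensional ℝ D.Vh
  Qth_finite : FiniteDimensional ℝ D.Qth
  infsup : ∀ q ∈ D.Qth,
    β * qtNorm m.μ q ≤ ⨆ v : D.Vh, inner ℝ (divg v.1) q / vNorm m.μ v.1
  Vh_approx : ∀ u ∈ V m.Ω m.Γd, (∀ i, MemHm (ku + 1) (fn (u i))) →
    ⨅ v : D.Vh, vNorm m.μ (u - v.1) ≤ cApp * h ^ ku * vecHmNorm (ku + 1) (fun i => fn (u i))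
  Qth_approx : ∀ q : L2 m.Ω, MemHm ku q →
    ⨅ r : D.Qth, qtNorm m.μ (q - r.1) ≤ cApp * h ^ ku * hmNorm ku q
  net_adm : ∀ i, (D.net i).Admissible (m.K i) kp cStab cApp h

section discrete

variable {d N : ℕ} {m : Medium d N}

/-- `A(p, q)`. -/
def Discretization.aForm (D : Discretization m) (p q : Fin N → L2 m.Ω) : ℝ :=
  ∑ i, (transferForm m.ξ i p (q i) + (D.net i).a (p i) (q i))

/-- `‖p‖_A`. -/
def Discretization.aNorm (D : Discretization m) (p : Fin N → L2 m.Ω) : ℝ :=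
  Real.sqrt (D.aForm p p)

/-- A triple (displacement, total pressure, network pressures). -/
@[ext] structure State (m : Medium d N) where
  u : Fin d → H1 m.Ω
  pt : L2 m.Ω
  p : Fin N → L2 m.Ω

instance : Sub (State m) := ⟨fun X Y => ⟨X.u - Y.u, X.pt - Y.pt, X.p - Y.p⟩⟩

/-- The state belongs to `V_h × Q_{t,h} × ∏ Q_{i,h}`. -/
structure Discretization.Mem (D : Discretization m) (X : State m) : Prop where
  u_mem : X.u ∈ D.Vh
  pt_mem : X.pt ∈ D.Qth
  p_mem : ∀ i, X.p i ∈ (D.net i).Qh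

/-- `P = (Π^V u, Π^{Q_t} pt, Π^Q p)`: the Lamé projection of `(u, pt)` and the elliptic projection
of `p`. -/
structure Discretization.IsProjection (D : Discretization m) (lam : ℝ) (X P : State m) :
    Prop where
  mem : D.Mem P
  lame₁ : ∀ v ∈ D.Vh, elasticForm m.μ P.u v - inner ℝ P.pt (divg v)
    = elasticForm m.μ X.u v - inner ℝ X.pt (divg v)
  lame₂ : ∀ q ∈ D.Qth, -inner ℝ (divg P.u) q - lam⁻¹ * inner ℝ P.pt q
    = -inner ℝ (divg X.u) q - lam⁻¹ * inner ℝ X.pt q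
  elliptic : ∀ q : Fin N → L2 m.Ω, (∀ i, q i ∈ (D.net i).Qh) → D.aForm P.p q = D.aForm X.p q

/-- The assumption on the discrete initial state `X0h`: `X0` is the exact initial state and `P0` its
projection. -/
structure Discretization.IsInitial (D : Discretization m) (ku : ℕ) (cInit h : ℝ)
    (X0 P0 X0h : State m) : Prop where
  mem : D.Mem X0h
  p_eq : X0h.p = P0.p
  bound : vNorm m.μ (X0.u - X0h.u) + qtNorm m.μ (X0.pt - X0h.pt)
    ≤ cInit * h ^ ku * (vecHmNorm (ku + 1) (fun i => fn (X0.u i)) + hmNorm ku X0.pt)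

/-- The monolithic step from `X0h` to `X1h` with step size `τ`: backward Euler for the elasticity
and total pressure equations, Crank-Nicolson for the network pressures. Here `f1` is the body force
at the new time, and `g0`, `g1` are the sources at the old and at the new time. -/
structure Discretization.IsMonolithicStep (D : Discretization m) (s : Fin N → ℝ) (lam τ : ℝ)
    (f1 : Fin d → L2 m.Ω) (g0 g1 : Fin N → L2 m.Ω) (X0h X1h : State m) : Prop where
  mem : D.Mem X1h
  elasticity : ∀ v ∈ D.Vh,
    elasticForm m.μ X1h.u v - inner ℝ X1h.pt (divg v) = ∑ i, inner ℝ (f1 i) (fn (v i))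
  totalPressure : ∀ q ∈ D.Qth,
    -inner ℝ (divg X1h.u) q - lam⁻¹ * inner ℝ X1h.pt q
      + lam⁻¹ * inner ℝ (dotα m.α X1h.p) q = 0
  diffusion : ∀ i, ∀ q ∈ (D.net i).Qh,
    -inner ℝ (s i • (τ⁻¹ • (X1h.p i - X0h.p i))) q
      - (inner ℝ ((m.α i * lam⁻¹) • (-(τ⁻¹ • (X1h.pt - X0h.pt))
          + dotα m.α (τ⁻¹ • (X1h.p - X0h.p)))) q
        + transferForm m.ξ i ((1 / 2 : ℝ) • (X0h.p + X1h.p)) q)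
      - (D.net i).a ((1 / 2 : ℝ) • (X0h.p i + X1h.p i)) q
    = -inner ℝ ((1 / 2 : ℝ) • (g0 i + g1 i)) q

end discrete

/-- The exact state at time `t`. -/
def stateAt {d N : ℕ} {m : Medium d N} (u : ℝ → Fin d → H1 m.Ω) (pt : ℝ → L2 m.Ω)
    (p : ℝ → Fin N → H1 m.Ω) (t : ℝ) : State m :=
  ⟨u t, pt t, fun i => (fn (p t i))⟩

end MPET

end

/-!
The step is compared with the projection of the exact solution. In the differential equation for
the network pressures the time derivatives, averaged over the end points of the step, are replaced
by the trapezoidal increment `(τ / 2) (x'(0) + x'(τ))`, which agrees with `x(τ) - x(0)` up to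
`O(τ³)` since `x` is `C³` with values in `L²`. The discrete errors therefore satisfy the homogeneous
step with defects `θ` (network pressures) and `ψ` (total pressure), both of size
`η = O(τ³ + h^kp + h^ku)` by the approximation properties of the projections. As `e_p` vanishes at
time `0`, testing the elasticity and total pressure equations with the errors at time `τ`, and the
diffusion equation with `e_p`, makes the coupling terms cancel and bounds
`‖e_u‖² + ‖√s e_p‖² + λ⁻¹ ‖e_pt - α · e_p‖² + τ ‖e_p‖_A²` by `O(η²)`; the inf-sup condition adds
`‖e_pt‖` to the left side.

Neither projection is orthogonal for the norm in which its error is needed, uniformly in `λ`: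
for the saddle point projection, `λ⁻¹ ≤ cLam / μ` gives a constant that does not depend on `λ`, and
for the elliptic one the exchange terms are bounded by the discrete Poincaré inequality.
-/

noncomputable section

namespace MPET

/-! ### Saddle point forms -/

section saddlePoint

variable {U E H : Type*} [AddCommGroup U] [Module ℝ U]
  [NormedAddCommGroup E] [InnerProductSpace ℝ E] [NormedAddCommGroup H] [InnerProductSpace ℝ H]
  {ε : U →ₗ[ℝ] E} {B : U →ₗ[ℝ] H} {Vh : Submodule ℝ U} {Qh : Submodule ℝ H}

/-- The inf-sup condition with constant `k⁻¹` for the form `⟪B v, q⟫` on `Vh × Qh`, where `U` is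
measured in the seminorm `‖ε v‖`. It is stated by duality, so that no quotient by `‖ε v‖` and no
supremum appears. -/
def InfSup (ε : U →ₗ[ℝ] E) (B : U →ₗ[ℝ] H) (Vh : Submodule ℝ U) (Qh : Submodule ℝ H) (k : ℝ) :
    Prop :=
  ∀ q ∈ Qh, ∀ c, 0 ≤ c → (∀ v ∈ Vh, inner ℝ q (B v) ≤ c * ‖ε v‖) → ‖q‖ ≤ k * c

lemma InfSup.norm_le {k : ℝ} (hk : InfSup ε B Vh Qh k) {t : H} (ht : t ∈ Qh) {u : U}
    (h : ∀ v ∈ Vh, inner ℝ (ε u) (ε v) = inner ℝ t (B v)) : ‖t‖ ≤ k * ‖ε u‖ :=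
  hk t ht _ (norm_nonneg _) fun v hv => h v hv ▸ real_inner_le_norm _ _

/-- `(Pu, Pp) ∈ Vh × Qh` is the Galerkin projection of `(u, p)` for the perturbed saddle point form
`⟪ε u, ε v⟫ - ⟪p, B v⟫ - ⟪B u, q⟫ - l ⟪p, q⟫`. -/
structure IsSaddleProjection (ε : U →ₗ[ℝ] E) (B : U →ₗ[ℝ] H) (Vh : Submodule ℝ U)
    (Qh : Submodule ℝ H) (l : ℝ) (u : U) (p : H) (Pu : U) (Pp : H) : Prop where
  left_mem : Pu ∈ Vh
  right_mem : Pp ∈ Qh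
  left_eq : ∀ v ∈ Vh, inner ℝ (ε Pu) (ε v) - inner ℝ Pp (B v)
    = inner ℝ (ε u) (ε v) - inner ℝ p (B v)
  right_eq : ∀ q ∈ Qh, -inner ℝ (B Pu) q - l * inner ℝ Pp q = -inner ℝ (B u) q - l * inner ℝ p q

/-- `y` is eliminated by the inf-sup bound `hy`, except in `l (t y - y²)`, which is at most
`Λ t² / 4`. -/
lemma le_of_saddle_energy {κ k Λ l x y r t : ℝ} (hκ : 0 ≤ κ) (hk : 0 ≤ k) (hl : 0 ≤ l)
    (hlΛ : l ≤ Λ) (hx : 0 ≤ x) (hr : 0 ≤ r) (ht : 0 ≤ t)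
    (henergy : x ^ 2 + l * y ^ 2 ≤ r * x + t * (κ * x) + κ * r * y + l * (t * y))
    (hy : y ≤ k * (x + r + κ * t)) :
    x ≤ 2 * ((1 + κ + κ * k + Λ) * (r + t)) := by
  have hΛ : 0 ≤ Λ := hl.trans hlΛ
  set a := (1 + κ + κ * k + Λ) * (r + t) with ha
  have ha0 : 0 ≤ a := by positivity
  have hyoung : l * (t * y) - l * y ^ 2 ≤ Λ * t ^ 2 / 4 := by
    nlinarith [mul_nonneg hl (sq_nonneg (y - t / 2)), mul_le_mul_of_nonneg_right hlΛ (sq_nonneg t)]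
  have hinfsup : κ * r * y ≤ κ * r * (k * (x + r + κ * t)) := by gcongr
  have hlinear : r + κ * t + κ * k * r ≤ a := by
    have : 0 ≤ (κ + Λ) * r + (1 + κ * k + Λ) * t := by positivity
    rw [ha]; linarith
  have hconst : κ * k * r * (r + κ * t) + Λ * t ^ 2 / 4 ≤ a ^ 2 := by
    have hleft : κ * k * r * (r + κ * t) ≤ κ * k * r * a := by
      have : 0 ≤ κ * k * r := by positivity
      gcongr
      linarith
    have hright : Λ * t * t ≤ Λ * t * a := by
      have : 0 ≤ (1 + κ + κ * k + Λ) * r + (κ + κ * k + Λ) * t := by positivity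
      gcongr
      rw [ha]; linarith
    have hsum : (κ * k * r + Λ * t) * a ≤ a * a := by
      have : 0 ≤ (1 + κ + Λ) * r + (1 + κ + κ * k) * t := by positivity
      gcongr
      rw [ha]; linarith
    linarith [mul_nonneg hΛ (sq_nonneg t)]
  have hquad : x ^ 2 ≤ a * x + a ^ 2 := by
    nlinarith [mul_le_mul_of_nonneg_right hlinear hx]
  nlinarith

namespace IsSaddleProjection

variable {l κ k Λ : ℝ} {u Pu : U} {p Pp : H}

lemma sub (hP : IsSaddleProjection ε B Vh Qh l u p Pu Pp) {v : U} (hv : v ∈ Vh) {q : H}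
    (hq : q ∈ Qh) : IsSaddleProjection ε B Vh Qh l (u - v) (p - q) (Pu - v) (Pp - q) where
  left_mem := sub_mem hP.left_mem hv
  right_mem := sub_mem hP.right_mem hq
  left_eq w hw := by
    have := hP.left_eq w hw
    simp only [map_sub, inner_sub_left]
    linarith
  right_eq r hr := by
    have := hP.right_eq r hr
    simp only [map_sub, inner_sub_left, mul_sub]
    linarith

lemma norm_right_le (hP : IsSaddleProjection ε B Vh Qh l u p Pu Pp) (hκ : 0 ≤ κ)
    (hB : ∀ v, ‖B v‖ ≤ κ * ‖ε v‖) (hk : InfSup ε B Vh Qh k) :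
    ‖Pp‖ ≤ k * (‖ε Pu‖ + ‖ε u‖ + κ * ‖p‖) := by
  refine hk Pp hP.right_mem _ (by positivity) fun v hv => ?_
  have hleft : -(‖ε Pu‖ * ‖ε v‖) ≤ -inner ℝ (ε Pu) (ε v) :=
    neg_le_neg (real_inner_le_norm _ _)
  have hu : -inner ℝ (ε u) (ε v) ≤ ‖ε u‖ * ‖ε v‖ :=
    (neg_le_abs _).trans (abs_real_inner_le_norm _ _)
  have hp : inner ℝ p (B v) ≤ ‖p‖ * (κ * ‖ε v‖) :=
    (real_inner_le_norm _ _).trans (by gcongr; exact hB v)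
  linarith [hP.left_eq v hv]

lemma energy_le (hP : IsSaddleProjection ε B Vh Qh l u p Pu Pp)
    (hB : ∀ v, ‖B v‖ ≤ κ * ‖ε v‖) (hl : 0 ≤ l) :
    ‖ε Pu‖ ^ 2 + l * ‖Pp‖ ^ 2 ≤ ‖ε u‖ * ‖ε Pu‖ + ‖p‖ * (κ * ‖ε Pu‖)
      + κ * ‖ε u‖ * ‖Pp‖ + l * (‖p‖ * ‖Pp‖) := by
  have hleft := hP.left_eq Pu hP.left_mem
  have hright := hP.right_eq Pp hP.right_mem
  rw [real_inner_self_eq_norm_sq] at hleft hright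
  have hswap : inner ℝ Pp (B Pu) = inner ℝ (B Pu) Pp := real_inner_comm _ _
  have huu : inner ℝ (ε u) (ε Pu) ≤ ‖ε u‖ * ‖ε Pu‖ := real_inner_le_norm _ _
  have hpu : -inner ℝ p (B Pu) ≤ ‖p‖ * (κ * ‖ε Pu‖) :=
    (neg_le_abs _).trans ((abs_real_inner_le_norm _ _).trans (by gcongr; exact hB Pu))
  have hup : inner ℝ (B u) Pp ≤ κ * ‖ε u‖ * ‖Pp‖ :=
    (real_inner_le_norm _ _).trans (by gcongr; exact hB u)
  have hpp : l * inner ℝ p Pp ≤ l * (‖p‖ * ‖Pp‖) := by gcongr; exact real_inner_le_norm _ _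
  linarith

lemma norm_le (hP : IsSaddleProjection ε B Vh Qh l u p Pu Pp) (hκ : 0 ≤ κ)
    (hB : ∀ v, ‖B v‖ ≤ κ * ‖ε v‖) (hk : InfSup ε B Vh Qh k) (hk0 : 0 ≤ k) (hl : 0 ≤ l)
    (hlΛ : l ≤ Λ) :
    ‖ε Pu‖ ≤ 2 * ((1 + κ + κ * k + Λ) * (‖ε u‖ + ‖p‖)) ∧
      ‖Pp‖ ≤ 3 * k * ((1 + κ + κ * k + Λ) * (‖ε u‖ + ‖p‖)) := by
  have hΛ : 0 ≤ Λ := hl.trans hlΛ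
  have hright := hP.norm_right_le hκ hB hk
  have hleft := le_of_saddle_energy hκ hk0 hl hlΛ (norm_nonneg _) (norm_nonneg (ε u))
    (norm_nonneg p) (hP.energy_le hB hl) hright
  refine ⟨hleft, hright.trans ?_⟩
  have hdata : ‖ε u‖ + κ * ‖p‖ ≤ (1 + κ + κ * k + Λ) * (‖ε u‖ + ‖p‖) := by
    have : 0 ≤ (κ + κ * k + Λ) * ‖ε u‖ + (1 + κ * k + Λ) * ‖p‖ := by positivity
    linarith
  rw [mul_comm 3 k, mul_assoc]
  exact mul_le_mul_of_nonneg_left (by linarith) hk0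

section galerkinError

variable {uh : U} {th r : H}

lemma inner_left_sub (hP : IsSaddleProjection ε B Vh Qh l u p Pu Pp)
    (hleft : ∀ v ∈ Vh, inner ℝ (ε uh) (ε v) - inner ℝ th (B v)
      = inner ℝ (ε u) (ε v) - inner ℝ p (B v)) {v : U} (hv : v ∈ Vh) :
    inner ℝ (ε (Pu - uh)) (ε v) = inner ℝ (Pp - th) (B v) := by
  rw [map_sub, inner_sub_left, inner_sub_left]
  linarith [hP.left_eq v hv, hleft v hv]

lemma norm_sq_sub_eq (hP : IsSaddleProjection ε B Vh Qh l u p Pu Pp) (huh : uh ∈ Vh)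
    (hth : th ∈ Qh)
    (hleft : ∀ v ∈ Vh, inner ℝ (ε uh) (ε v) - inner ℝ th (B v)
      = inner ℝ (ε u) (ε v) - inner ℝ p (B v))
    (hright : ∀ q ∈ Qh, -inner ℝ (B uh) q - l * inner ℝ th q
      = -inner ℝ (B u) q - l * inner ℝ p q + l * inner ℝ r q) :
    ‖ε (Pu - uh)‖ ^ 2 + l * ‖Pp - th‖ ^ 2 = l * inner ℝ r (Pp - th) := by
  have hu := hP.inner_left_sub hleft (sub_mem hP.left_mem huh)
  have hp : inner ℝ (B (Pu - uh)) (Pp - th) + l * inner ℝ (Pp - th) (Pp - th)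
      = l * inner ℝ r (Pp - th) := by
    have hq : Pp - th ∈ Qh := sub_mem hP.right_mem hth
    rw [map_sub, inner_sub_left, inner_sub_left Pp]
    linarith [hP.right_eq _ hq, hright _ hq]
  rw [real_inner_self_eq_norm_sq] at hu hp
  rw [hu, real_inner_comm, hp]

end galerkinError

end IsSaddleProjection

/-- The quasi-optimality constant of the saddle point projection, for `‖B‖ ≤ κ`, inf-sup constant
`k⁻¹` and perturbation parameter at most `Λ`. -/
def saddleConst (κ k Λ : ℝ) : ℝ := 3 * (1 + k) * (1 + κ + κ * k + Λ)

lemma saddleConst_nonneg {κ k Λ : ℝ} (hκ : 0 ≤ κ) (hk : 0 ≤ k) (hΛ : 0 ≤ Λ) :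
    0 ≤ saddleConst κ k Λ := by
  unfold saddleConst; positivity

lemma IsSaddleProjection.quasiOptimal {l κ k Λ : ℝ} {u Pu v : U} {p Pp q : H}
    (hP : IsSaddleProjection ε B Vh Qh l u p Pu Pp) (hκ : 0 ≤ κ)
    (hB : ∀ v, ‖B v‖ ≤ κ * ‖ε v‖) (hk : InfSup ε B Vh Qh k) (hk0 : 0 ≤ k) (hl : 0 ≤ l)
    (hlΛ : l ≤ Λ) (hv : v ∈ Vh) (hq : q ∈ Qh) :
    ‖ε (u - Pu)‖ ≤ saddleConst κ k Λ * (‖ε (u - v)‖ + ‖p - q‖) ∧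
      ‖p - Pp‖ ≤ saddleConst κ k Λ * (‖ε (u - v)‖ + ‖p - q‖) := by
  have hΛ : 0 ≤ Λ := hl.trans hlΛ
  obtain ⟨hPu, hPp⟩ := (hP.sub hv hq).norm_le hκ hB hk hk0 hl hlΛ
  set w := ‖ε (u - v)‖ + ‖p - q‖
  set c := (1 + κ + κ * k + Λ) * w with hc
  have hw0 : 0 ≤ w := by positivity
  have hc0 : 0 ≤ c := by positivity
  have hwc : w ≤ c := le_mul_of_one_le_left hw0 (by linarith [mul_nonneg hκ hk0])
  have hconst : saddleConst κ k Λ * w = 3 * c + 3 * k * c := by rw [saddleConst, hc]; ring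
  have hkc : 0 ≤ k * c := mul_nonneg hk0 hc0
  have hu : ‖ε (u - Pu)‖ ≤ ‖ε (u - v)‖ + ‖ε (Pu - v)‖ := by
    simpa only [map_sub, sub_sub_sub_cancel_right] using norm_sub_le (ε (u - v)) (ε (Pu - v))
  have hp : ‖p - Pp‖ ≤ ‖p - q‖ + ‖Pp - q‖ := by
    simpa only [sub_sub_sub_cancel_right] using norm_sub_le (p - q) (Pp - q)
  constructor <;> linarith [norm_nonneg (ε (u - v)), norm_nonneg (p - q)]

end saddlePoint

section energy

variable {F H : Type*} [NormedAddCommGroup F] [InnerProductSpace ℝ F]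
  [NormedAddCommGroup H] [InnerProductSpace ℝ H]

/-- Adding the two balances, the left side becomes a sum of squares because the coupling terms
complete `l ‖t - r‖²`; on the right `l ⟪a, t⟫ + l ⟪c, r⟫ = l ⟪a + c, t⟫ - l ⟪c, t - r⟫`, and `t` is
controlled by `x` alone, so every term is absorbed uniformly for small `l`. -/
lemma energy_le_of_balances {x A l k : ℝ} {e θ : F} {t r a c : H} (hl : 0 ≤ l)
    (ht : ‖t‖ ≤ k * x) (hstokes : x ^ 2 + l * ‖t‖ ^ 2 = l * inner ℝ (r + a) t)
    (hpressure : ‖e‖ ^ 2 + l * ‖r‖ ^ 2 - l * inner ℝ t r + A = l * inner ℝ c r - inner ℝ θ e) :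
    x ^ 2 + ‖e‖ ^ 2 + l * ‖t - r‖ ^ 2 + 2 * A
      ≤ l ^ 2 * k ^ 2 * ‖a + c‖ ^ 2 + l * ‖c‖ ^ 2 + ‖θ‖ ^ 2 := by
  have hsum : x ^ 2 + ‖e‖ ^ 2 + l * ‖t - r‖ ^ 2 + A
      = l * inner ℝ (a + c) t - l * inner ℝ c (t - r) - inner ℝ θ e := by
    rw [inner_add_left, real_inner_comm t r] at hstokes
    rw [norm_sub_sq_real, inner_add_left, inner_sub_right]
    linarith
  have htotal : 2 * (l * inner ℝ (a + c) t) ≤ l ^ 2 * k ^ 2 * ‖a + c‖ ^ 2 + x ^ 2 := by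
    have : l * inner ℝ (a + c) t ≤ l * (‖a + c‖ * (k * x)) := by
      gcongr
      exact (real_inner_le_norm _ _).trans (by gcongr)
    linarith [sq_nonneg (l * k * ‖a + c‖ - x)]
  have hcoupled : -(2 * (l * inner ℝ c (t - r))) ≤ l * ‖c‖ ^ 2 + l * ‖t - r‖ ^ 2 := by
    have := mul_nonneg hl (sq_nonneg ‖c + (t - r)‖)
    rw [norm_add_sq_real] at this
    linarith
  have hstorage : -(2 * inner ℝ θ e) ≤ ‖θ‖ ^ 2 + ‖e‖ ^ 2 := by
    have := sq_nonneg ‖θ + e‖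
    rw [norm_add_sq_real] at this
    linarith
  linarith

end energy

/-! ### Function spaces, exchange and elasticity forms -/

section multiplier

variable {X ι : Type*} [MeasurableSpace X] [Fintype ι] {ν : Measure X} {a b : X → ℝ}

/-- Multiplication by a bounded function, as an operator on `L²(ν)`. -/
def mulL2 (ha : MemLp a ∞ ν) : Lp ℝ 2 ν →L[ℝ] Lp ℝ 2 ν :=
  (ContinuousLinearMap.mul ℝ ℝ).holderL ν ∞ 2 2 (ha.toLp a)

lemma coeFn_mulL2 (ha : MemLp a ∞ ν) (u : Lp ℝ 2 ν) : mulL2 ha u =ᵐ[ν] fun x => a x * u x := by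
  filter_upwards [(ContinuousLinearMap.mul ℝ ℝ).coeFn_holder (r := 2) (ha.toLp a) u,
    ha.coeFn_toLp] with x hmul hcoe
  rw [← hcoe]
  exact hmul

lemma mulL2_congr (ha : MemLp a ∞ ν) (hb : MemLp b ∞ ν) (hab : a =ᵐ[ν] b) :
    mulL2 ha = mulL2 hb := by
  rw [mulL2, mulL2, (MemLp.toLp_eq_toLp_iff ha hb).2 hab]

lemma inner_eq_integral_mul (u v : Lp ℝ 2 ν) : inner ℝ u v = ∫ x, u x * v x ∂ν := by
  simp only [L2.inner_def, RCLike.inner_apply, conj_trivial, mul_comm]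

lemma inner_mulL2_self_nonneg (ha : MemLp a ∞ ν) (h0 : 0 ≤ᵐ[ν] a) (u : Lp ℝ 2 ν) :
    0 ≤ inner ℝ (mulL2 ha u) u := by
  rw [inner_eq_integral_mul]
  refine integral_nonneg_of_ae ?_
  filter_upwards [coeFn_mulL2 ha u, h0] with x hx hax
  rw [hx, mul_assoc]
  exact mul_nonneg hax (mul_self_nonneg _)

lemma coeFn_sum_mulL2 {c : ι → X → ℝ} (hc : ∀ i, MemLp (c i) ∞ ν) (v : ι → Lp ℝ 2 ν) :
    (∑ i, mulL2 (hc i) (v i) : Lp ℝ 2 ν) =ᵐ[ν] fun x => ∑ i, c i x * v i x := by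
  filter_upwards [Lp.coeFn_finsetSum Finset.univ fun i => mulL2 (hc i) (v i),
    ae_all_iff.2 fun i => coeFn_mulL2 (hc i) (v i)] with x hsum hmul
  rw [hsum, Finset.sum_apply]
  exact Finset.sum_congr rfl fun i _ => hmul i

/-- The exchange operator `p ↦ (∑ j, ξ j i (p i - p j))_i`. -/
def transferOp {ξ : ι → ι → X → ℝ} (hξ : ∀ j i, MemLp (ξ j i) ∞ ν) :
    (ι → Lp ℝ 2 ν) →L[ℝ] (ι → Lp ℝ 2 ν) :=
  .pi fun i => ∑ j, mulL2 (hξ j i) ∘L (.proj i - .proj j)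

lemma transferOp_apply {ξ : ι → ι → X → ℝ} (hξ : ∀ j i, MemLp (ξ j i) ∞ ν) (p : ι → Lp ℝ 2 ν)
    (i : ι) : transferOp hξ p i = ∑ j, mulL2 (hξ j i) (p i - p j) := by
  simp [transferOp]

/-- Summation by parts: by the symmetry of `ξ`, twice the form is the sum of
`⟪ξ j i (p i - p j), p i - p j⟫`. -/
lemma sum_inner_transferOp_self_nonneg {ξ : ι → ι → X → ℝ} (hξ : ∀ j i, MemLp (ξ j i) ∞ ν)
    (h0 : ∀ j i, 0 ≤ᵐ[ν] ξ j i) (hsymm : ∀ j i, ξ j i =ᵐ[ν] ξ i j) (p : ι → Lp ℝ 2 ν) :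
    0 ≤ ∑ i, inner ℝ (transferOp hξ p i) (p i) := by
  have hsum : ∑ i, inner ℝ (transferOp hξ p i) (p i)
      = ∑ i, ∑ j, inner ℝ (mulL2 (hξ j i) (p i - p j)) (p i) := by
    simp only [transferOp_apply, sum_inner]
  have hswap : ∑ i, inner ℝ (transferOp hξ p i) (p i)
      = ∑ i, ∑ j, -inner ℝ (mulL2 (hξ j i) (p i - p j)) (p j) := by
    rw [hsum, Finset.sum_comm]
    refine Finset.sum_congr rfl fun i _ => Finset.sum_congr rfl fun j _ => ?_
    rw [mulL2_congr (hξ i j) (hξ j i) (hsymm i j), ← neg_sub (p i), map_neg, inner_neg_left]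
  have hdouble : 2 * ∑ i, inner ℝ (transferOp hξ p i) (p i)
      = ∑ i, ∑ j, inner ℝ (mulL2 (hξ j i) (p i - p j)) (p i - p j) := by
    rw [two_mul]
    nth_rewrite 1 [hsum]
    simp only [hswap, ← Finset.sum_add_distrib, ← sub_eq_add_neg, ← inner_sub_right]
  have hnonneg : 0 ≤ ∑ i, ∑ j, inner ℝ (mulL2 (hξ j i) (p i - p j)) (p i - p j) :=
    Finset.sum_nonneg fun i _ => Finset.sum_nonneg fun j _ =>
      inner_mulL2_self_nonneg (hξ j i) (h0 j i) _
  linarith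

end multiplier

section forms

variable {d N : ℕ} {Ω : Set (Pt d)}

lemma transferForm_eq_inner {ξ : Fin N → Fin N → Pt d → ℝ}
    (hξ : ∀ j i, MemLp (ξ j i) ∞ (volume.restrict Ω)) (i : Fin N) (p : Fin N → L2 Ω) (q : L2 Ω) :
    transferForm ξ i p q = inner ℝ (transferOp hξ p i) q := by
  rw [transferOp_apply, inner_eq_integral_mul, transferForm]
  refine integral_congr_ae ?_
  filter_upwards [coeFn_sum_mulL2 (fun j => hξ j i) fun j => p i - p j,
    ae_all_iff.2 fun j => Lp.coeFn_sub (p i) (p j)] with x hsum hsub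
  simp only [hsum, hsub, Pi.sub_apply]

lemma diffusionForm_eq_inner {K : Pt d → Matrix (Fin d) (Fin d) ℝ}
    (hK : ∀ j k, MemLp (fun x => K x j k) ∞ (volume.restrict Ω)) (w q : H1 Ω) :
    diffusionForm K w q = ∑ j, inner ℝ (∑ k, mulL2 (hK j k) (grad w k)) (grad q j) := by
  simp only [inner_eq_integral_mul]
  rw [← integral_finsetSum _ fun j _ => (Lp.memLp _).integrable_mul (Lp.memLp _)]
  refine integral_congr_ae ?_
  filter_upwards [ae_all_iff.2 fun j => coeFn_sum_mulL2 (hK j) (grad w)] with x hx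
  simp only [hx]

lemma continuous_grad (j : Fin d) : Continuous fun v : H1 Ω => grad v j :=
  (continuous_apply j).comp (continuous_snd.comp continuous_subtype_val)

lemma continuous_diffusionForm_left {K : Pt d → Matrix (Fin d) (Fin d) ℝ}
    (hK : ∀ j k, MemLp (fun x => K x j k) ∞ (volume.restrict Ω)) (q : H1 Ω) :
    Continuous fun w => diffusionForm K w q := by
  simp only [diffusionForm_eq_inner hK]
  exact continuous_finsetSum _ fun j _ => Continuous.inner
    (continuous_finsetSum _ fun k _ => (mulL2 (hK j k)).continuous.comp (continuous_grad k))
    continuous_const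

end forms

section matrixEntries

variable {ι : Type*} [Fintype ι] {A : Matrix ι ι ℝ} {c : ℝ}

lemma abs_dotProduct_mulVec_le (hA : A.IsSymm) (hnonneg : ∀ v, 0 ≤ dotProduct v (A.mulVec v))
    (hle : ∀ v, dotProduct v (A.mulVec v) ≤ c * ∑ i, v i ^ 2) (v w : ι → ℝ) :
    |dotProduct v (A.mulVec w)| ≤ c * (∑ i, v i ^ 2 + ∑ i, w i ^ 2) / 2 := by
  have hswap : dotProduct w (A.mulVec v) = dotProduct v (A.mulVec w) := by
    rw [Matrix.dotProduct_mulVec, ← Matrix.mulVec_transpose, hA.eq, dotProduct_comm]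
  have hpolar : 4 * dotProduct v (A.mulVec w)
      = dotProduct (v + w) (A.mulVec (v + w)) - dotProduct (v - w) (A.mulVec (v - w)) := by
    simp only [Matrix.mulVec_add, Matrix.mulVec_sub, add_dotProduct, sub_dotProduct,
      dotProduct_add, dotProduct_sub, hswap]
    ring
  have hparallelogram : ∑ i, (v + w) i ^ 2 + ∑ i, (v - w) i ^ 2
      = 2 * (∑ i, v i ^ 2 + ∑ i, w i ^ 2) := by
    simp only [← Finset.sum_add_distrib, Finset.mul_sum, Pi.add_apply, Pi.sub_apply]
    exact Finset.sum_congr rfl fun i _ => by ring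
  have hsum : c * ∑ i, (v + w) i ^ 2 + c * ∑ i, (v - w) i ^ 2
      = 2 * (c * (∑ i, v i ^ 2 + ∑ i, w i ^ 2)) := by
    rw [← mul_add, hparallelogram]
    ring
  rw [abs_le]
  constructor <;> linarith [hnonneg (v + w), hnonneg (v - w), hle (v + w), hle (v - w)]

lemma abs_apply_le_of_dotProduct_mulVec_le (hA : A.IsSymm)
    (hnonneg : ∀ v, 0 ≤ dotProduct v (A.mulVec v))
    (hle : ∀ v, dotProduct v (A.mulVec v) ≤ c * ∑ i, v i ^ 2) (j k : ι) : |A j k| ≤ c := by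
  classical
  have h := abs_dotProduct_mulVec_le hA hnonneg hle (Pi.single j 1) (Pi.single k 1)
  simpa [Pi.single_apply, one_add_one_eq_two] using h

end matrixEntries

section medium

variable {d N : ℕ} {m : Medium d N}

/-- What the error analysis needs to know about the medium: `μ` is positive, the conductivities and
exchange coefficients are essentially bounded on `Ω`, and the latter are nonnegative and
symmetric. -/
structure Medium.HasBoundedCoefficients (m : Medium d N) : Prop where
  μ_pos : 0 < m.μ
  K_memLp : ∀ i j k, MemLp (fun x => m.K i x j k) ∞ (volume.restrict m.Ω)
  ξ_memLp : ∀ j i, MemLp (m.ξ j i) ∞ (volume.restrict m.Ω)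
  ξ_nonneg : ∀ j i, 0 ≤ᵐ[volume.restrict m.Ω] m.ξ j i
  ξ_symm : ∀ j i, m.ξ j i =ᵐ[volume.restrict m.Ω] m.ξ i j

lemma Medium.Admissible.hasBoundedCoefficients (hm : m.Admissible) :
    m.HasBoundedCoefficients where
  μ_pos := hm.μ_pos
  K_memLp i j k := by
    obtain ⟨Klo, Khi, hKlo, -, hK⟩ := hm.K_elliptic i
    refine memLp_top_of_bound (hm.K_meas i j k).aestronglyMeasurable Khi ?_
    filter_upwards [hK, hm.K_symm i] with x hx hsymm
    exact abs_apply_le_of_dotProduct_mulVec_le hsymm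
      (fun v => le_trans (by positivity) (hx v).1) (fun v => (hx v).2) j k
  ξ_memLp j i := by
    obtain ⟨c, hc⟩ := hm.ξ_bdd
    refine memLp_top_of_bound (hm.ξ_meas j i).aestronglyMeasurable c ?_
    filter_upwards [hc j i, hm.ξ_nonneg j i] with x hx hx0
    rwa [Real.norm_of_nonneg hx0]
  ξ_nonneg := hm.ξ_nonneg
  ξ_symm := hm.ξ_symm

end medium

section trapezoid

variable {E : Type*} [NormedAddCommGroup E] [NormedSpace ℝ E] {f : ℝ → E} {a b x C : ℝ}

/-- The trapezoidal approximation of `f x - f a`, that is, of the integral of `f'` over `[a, x]`,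
where `f` lives on `[a, b]`. -/
def trapezoid (a b x : ℝ) (f : ℝ → E) : E :=
  ((x - a) / 2) • (derivWithin f (Icc a b) a + derivWithin f (Icc a b) x)

/-- The second derivative at `a` cancels between the Taylor expansions of `f` and of `f'`. -/
lemma norm_trapezoid_sub_le (hab : a < b) (hx : x ∈ Icc a b) (hf : ContDiffOn ℝ 3 f (Icc a b))
    (hC : ∀ y ∈ Icc a b, ‖iteratedDerivWithin 3 f (Icc a b) y‖ ≤ C) :
    ‖trapezoid a b x f - (f x - f a)‖ ≤ C * (x - a) ^ 3 := by
  have hxa : 0 ≤ (x - a) / 2 := by linarith [hx.1]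
  have htaylor := taylor_mean_remainder_bound (n := 2) hab.le (by exact_mod_cast hf) hx hC
  have hf' : ContDiffOn ℝ 2 (derivWithin f (Icc a b)) (Icc a b) :=
    hf.derivWithin (uniqueDiffOn_Icc hab) (by norm_num)
  have htaylor' := taylor_mean_remainder_bound (n := 1) (C := C) hab.le (by exact_mod_cast hf') hx
    fun y hy => by
      rw [← iteratedDerivWithin_succ']
      exact hC y hy
  have hsecond : iteratedDerivWithin 2 f (Icc a b) a
      = derivWithin (derivWithin f (Icc a b)) (Icc a b) a := by
    rw [iteratedDerivWithin_succ', iteratedDerivWithin_one]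
  set f' := derivWithin f (Icc a b) with hf'_def
  set f'' := derivWithin f' (Icc a b) a
  simp only [taylorWithinEval_succ, taylor_within_zero_eval, hsecond] at htaylor htaylor'
  norm_num [Nat.factorial] at htaylor htaylor'
  have hcancel : trapezoid a b x f - (f x - f a)
      = ((x - a) / 2) • (f' x - (f' a + (x - a) • f''))
        - (f x - (f a + (x - a) • f' a + (1 / 2 * (x - a) ^ 2) • f'')) := by
    rw [trapezoid, ← hf'_def]
    module
  rw [hcancel]
  refine (norm_sub_le _ _).trans ?_
  rw [norm_smul, Real.norm_of_nonneg hxa]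
  calc _ ≤ (x - a) / 2 * (C * (x - a) ^ 2) + C * (x - a) ^ 3 / 2 :=
        add_le_add (mul_le_mul_of_nonneg_left htaylor' hxa) htaylor
    _ = C * (x - a) ^ 3 := by ring

end trapezoid

section elasticity

variable {d : ℕ} {Ω : Set (Pt d)} {μ : ℝ}

lemma grad_add (u v : H1 Ω) (j : Fin d) : grad (u + v) j = grad u j + grad v j := rfl

lemma grad_smul (c : ℝ) (u : H1 Ω) (j : Fin d) : grad (c • u) j = c • grad u j := rfl

/-- The scaled symmetric gradient `√(2μ) ε(u)`, which embeds the elastic energy in a Hilbert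
space. -/
def strainMap (μ : ℝ) : (Fin d → H1 Ω) →ₗ[ℝ] PiLp 2 (fun _ : Fin d × Fin d => L2 Ω) where
  toFun u := WithLp.toLp 2 (fun ij => Real.sqrt (2 * μ) • strain u ij.1 ij.2)
  map_add' u v := by
    ext1 ij
    simp only [strain, Pi.add_apply, grad_add, PiLp.add_apply]
    module
  map_smul' c u := by
    ext1 ij
    simp only [strain, Pi.smul_apply, grad_smul, PiLp.smul_apply, RingHom.id_apply]
    module

lemma strainMap_apply (u : Fin d → H1 Ω) (i j : Fin d) :
    strainMap μ u (i, j) = Real.sqrt (2 * μ) • strain u i j := rfl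

lemma elasticForm_eq_inner (hμ : 0 ≤ μ) (u v : Fin d → H1 Ω) :
    elasticForm μ u v = inner ℝ (strainMap μ u) (strainMap μ v) := by
  have hsq : Real.sqrt (2 * μ) * Real.sqrt (2 * μ) = 2 * μ := Real.mul_self_sqrt (by positivity)
  simp only [elasticForm, PiLp.inner_apply, Fintype.sum_prod_type, strainMap_apply,
    inner_smul_left, inner_smul_right, conj_trivial, Finset.mul_sum, ← mul_assoc, hsq]

lemma vNorm_eq_norm (hμ : 0 ≤ μ) (u : Fin d → H1 Ω) : vNorm μ u = ‖strainMap μ u‖ := by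
  rw [vNorm, elasticForm_eq_inner hμ, real_inner_self_eq_norm_sq, Real.sqrt_sq (norm_nonneg _)]

lemma vNorm_sub_le (hμ : 0 ≤ μ) (u v : Fin d → H1 Ω) :
    vNorm μ (u - v) ≤ vNorm μ u + vNorm μ v := by
  simp only [vNorm_eq_norm hμ, map_sub]
  exact norm_sub_le _ _

/-- The divergence as a linear map. -/
def divMap : (Fin d → H1 Ω) →ₗ[ℝ] L2 Ω where
  toFun := divg
  map_add' u v := by simp only [divg, Pi.add_apply, grad_add, Finset.sum_add_distrib]
  map_smul' c u := by simp only [divg, Pi.smul_apply, grad_smul, Finset.smul_sum, RingHom.id_apply]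

lemma divMap_apply (v : Fin d → H1 Ω) : divMap v = divg v := rfl

lemma qtNorm_eq (q : L2 Ω) : qtNorm μ q = (Real.sqrt (2 * μ))⁻¹ * ‖q‖ := by
  rw [qtNorm, real_inner_self_eq_norm_sq, Real.sqrt_mul' _ (sq_nonneg _),
    Real.sqrt_sq (norm_nonneg _), Real.sqrt_inv]

lemma norm_eq_qtNorm (hμ : 0 < μ) (q : L2 Ω) : ‖q‖ = Real.sqrt (2 * μ) * qtNorm μ q := by
  rw [qtNorm_eq, mul_inv_cancel_left₀ (Real.sqrt_pos.2 (by positivity)).ne']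

lemma qtNorm_sub_le (p q : L2 Ω) : qtNorm μ (p - q) ≤ qtNorm μ p + qtNorm μ q := by
  simp only [qtNorm_eq, ← mul_add]
  gcongr
  exact norm_sub_le _ _

lemma sqrt_mul_norm_grad_le (v : Fin d → H1 Ω) (i : Fin d) :
    Real.sqrt (2 * μ) * ‖grad (v i) i‖ ≤ ‖strainMap μ v‖ := by
  have hstrain : strainMap μ v (i, i) = Real.sqrt (2 * μ) • grad (v i) i := by
    rw [strainMap_apply, strain, ← two_smul ℝ, smul_smul _ (2 : ℝ), one_div,
      inv_mul_cancel₀ two_ne_zero, one_smul]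
  calc Real.sqrt (2 * μ) * ‖grad (v i) i‖ = ‖strainMap μ v (i, i)‖ := by
        rw [hstrain, norm_smul, Real.norm_of_nonneg (Real.sqrt_nonneg _)]
    _ ≤ ‖strainMap μ v‖ := PiLp.norm_apply_le (strainMap μ v) (i, i)

lemma norm_divMap_le (hμ : 0 < μ) (v : Fin d → H1 Ω) :
    ‖divMap v‖ ≤ d * (Real.sqrt (2 * μ))⁻¹ * ‖strainMap μ v‖ := by
  have hdiag (i : Fin d) : ‖grad (v i) i‖ ≤ (Real.sqrt (2 * μ))⁻¹ * ‖strainMap μ v‖ := by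
    rw [le_inv_mul_iff₀ (Real.sqrt_pos.2 (by positivity))]
    exact sqrt_mul_norm_grad_le v i
  rw [divMap_apply, divg]
  calc ‖∑ i, grad (v i) i‖ ≤ ∑ i, ‖grad (v i) i‖ := norm_sum_le _ _
    _ ≤ ∑ _i : Fin d, (Real.sqrt (2 * μ))⁻¹ * ‖strainMap μ v‖ :=
        Finset.sum_le_sum fun i _ => hdiag i
    _ = d * (Real.sqrt (2 * μ))⁻¹ * ‖strainMap μ v‖ := by simp [mul_assoc]

lemma Discretization.Admissible.infSup {N : ℕ} {m : Medium d N} {D : Discretization m}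
    {ku kp : ℕ} {β cStab cApp h : ℝ} (hD : D.Admissible ku kp β cStab cApp h) (hμ : 0 < m.μ)
    (hβ : 0 < β) : InfSup (strainMap m.μ) divMap D.Vh D.Qth (Real.sqrt (2 * m.μ) / β) := by
  intro q hq c hc hqc
  have hquot (v : D.Vh) : inner ℝ (divg v.1) q / vNorm m.μ v.1 ≤ c := by
    refine div_le_of_le_mul₀ (Real.sqrt_nonneg _) hc ?_
    rw [real_inner_comm, vNorm_eq_norm hμ.le]
    exact hqc v.1 v.2
  rw [norm_eq_qtNorm hμ, div_mul_eq_mul_div, mul_div_assoc]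
  gcongr
  rw [le_div_iff₀' hβ]
  exact (hD.infsup q hq).trans (ciSup_le hquot)

end elasticity

/-! ### Network pressures and elliptic projection -/

section storage

variable {d N : ℕ} {Ω : Set (Pt d)} {s α : Fin N → ℝ} {lam : ℝ}

/-- `p ↦ α · p` as a continuous linear map. -/
def dotαL (α : Fin N → ℝ) : (Fin N → L2 Ω) →L[ℝ] L2 Ω := ∑ i, α i • .proj i

lemma dotαL_apply (p : Fin N → L2 Ω) : dotαL α p = dotα α p := by
  simp [dotαL, dotα]

/-- `p ↦ (√s_i p_i)_i`, which embeds the first part of the form `S` in a Hilbert space. -/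
def storageMap (s : Fin N → ℝ) : (Fin N → L2 Ω) →ₗ[ℝ] PiLp 2 (fun _ : Fin N => L2 Ω) where
  toFun p := WithLp.toLp 2 fun i => Real.sqrt (s i) • p i
  map_add' p q := by
    ext1 i
    simp only [Pi.add_apply, PiLp.add_apply, smul_add]
  map_smul' c p := by
    ext1 i
    simp only [Pi.smul_apply, PiLp.smul_apply, RingHom.id_apply, smul_comm c]

lemma storageMap_apply (p : Fin N → L2 Ω) (i : Fin N) :
    storageMap s p i = Real.sqrt (s i) • p i := rfl

lemma sForm_eq_inner (hs : ∀ i, 0 ≤ s i) (p q : Fin N → L2 Ω) :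
    sForm s α lam p q = inner ℝ (storageMap s p) (storageMap s q)
      + lam⁻¹ * inner ℝ (dotαL α p) (dotαL α q) := by
  have hsq (i : Fin N) : Real.sqrt (s i) * Real.sqrt (s i) = s i := Real.mul_self_sqrt (hs i)
  simp only [sForm, dotαL_apply, PiLp.inner_apply, storageMap_apply, inner_smul_left,
    inner_smul_right, conj_trivial, ← mul_assoc, hsq]

lemma sNorm_sq (hs : ∀ i, 0 ≤ s i) (hlam : 0 ≤ lam) (p : Fin N → L2 Ω) :
    sNorm s α lam p ^ 2 = ‖storageMap s p‖ ^ 2 + lam⁻¹ * ‖dotαL α p‖ ^ 2 := by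
  rw [sNorm, sForm_eq_inner hs, real_inner_self_eq_norm_sq, real_inner_self_eq_norm_sq,
    Real.sq_sqrt (by positivity)]

lemma norm_storageMap_sq_le {sMax : ℝ} (hs : ∀ i, 0 ≤ s i ∧ s i ≤ sMax) (p : Fin N → L2 Ω) :
    ‖storageMap s p‖ ^ 2 ≤ N * sMax * ‖p‖ ^ 2 := by
  have hcomponent (i : Fin N) : ‖storageMap s p i‖ ^ 2 ≤ sMax * ‖p‖ ^ 2 := by
    rw [storageMap_apply, norm_smul, Real.norm_of_nonneg (Real.sqrt_nonneg _), mul_pow,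
      Real.sq_sqrt (hs i).1]
    gcongr
    · exact (hs i).1.trans (hs i).2
    · exact (hs i).2
    · exact norm_le_pi_norm p i
  calc ‖storageMap s p‖ ^ 2 = ∑ i, ‖storageMap s p i‖ ^ 2 := PiLp.norm_sq_eq_of_L2 _ _
    _ ≤ ∑ _i : Fin N, sMax * ‖p‖ ^ 2 := Finset.sum_le_sum fun i _ => hcomponent i
    _ = N * sMax * ‖p‖ ^ 2 := by simp [mul_assoc]

/-- The time derivative terms `s_i w_i + α_i λ⁻¹ (-z + α · w)` of the pressure equations, as a
function of the rates `w` of the network pressures and `z` of the total pressure. -/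
def storageRate (s α : Fin N → ℝ) (lam : ℝ) : (Fin N → L2 Ω) × L2 Ω →L[ℝ] (Fin N → L2 Ω) :=
  .pi fun i => s i • .proj i ∘L .fst ℝ _ _
    + (α i * lam⁻¹) • (-.snd ℝ _ _ + dotαL α ∘L .fst ℝ _ _)

lemma storageRate_apply (w : Fin N → L2 Ω) (z : L2 Ω) (i : Fin N) :
    storageRate s α lam (w, z) i = s i • w i + (α i * lam⁻¹) • (-z + dotα α w) := by
  simp [storageRate, dotαL_apply]

lemma sum_inner_storageRate (w : Fin N → L2 Ω) (z : L2 Ω) (q : Fin N → L2 Ω) :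
    ∑ i, inner ℝ (storageRate s α lam (w, z) i) (q i)
      = sForm s α lam w q - lam⁻¹ * inner ℝ z (dotα α q) := by
  have hcoupling (y : L2 Ω) :
      ∑ i, α i * lam⁻¹ * inner ℝ y (q i) = lam⁻¹ * inner ℝ y (dotα α q) := by
    simp only [dotα, inner_sum, inner_smul_right, Finset.mul_sum]
    exact Finset.sum_congr rfl fun i _ => by ring
  have hterm (i : Fin N) : inner ℝ (storageRate s α lam (w, z) i) (q i)
      = s i * inner ℝ (w i) (q i) + α i * lam⁻¹ * inner ℝ (-z + dotα α w) (q i) := by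
    rw [storageRate_apply, inner_add_left, real_inner_smul_left, real_inner_smul_left]
  rw [Finset.sum_congr rfl fun i _ => hterm i, Finset.sum_add_distrib, hcoupling, inner_add_left,
    inner_neg_left, sForm]
  ring

lemma sum_inner_storageRate_add_self (hs : ∀ i, 0 ≤ s i) (θ e : Fin N → L2 Ω) (ψ t : L2 Ω) :
    ∑ i, inner ℝ (storageRate s α lam (θ + e, ψ + t) i) (e i)
      = ‖storageMap s e‖ ^ 2 + lam⁻¹ * ‖dotαL α e‖ ^ 2 - lam⁻¹ * inner ℝ t (dotαL α e)
        + inner ℝ (storageMap s θ) (storageMap s e)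
        - lam⁻¹ * inner ℝ (ψ - dotαL α θ) (dotαL α e) := by
  have htotal : inner ℝ (ψ + t) (dotαL α e)
      = inner ℝ ψ (dotαL α e) + inner ℝ t (dotαL α e) := inner_add_left _ _ _
  have hdefect : inner ℝ (ψ - dotαL α θ) (dotαL α e)
      = inner ℝ ψ (dotαL α e) - inner ℝ (dotαL α θ) (dotαL α e) := inner_sub_left _ _ _
  have hdot : inner ℝ (dotαL α (θ + e)) (dotαL α e)
      = inner ℝ (dotαL α θ) (dotαL α e) + ‖dotαL α e‖ ^ 2 := by
    simp only [map_add, inner_add_left, real_inner_self_eq_norm_sq]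
  have hstorage : inner ℝ (storageMap s (θ + e)) (storageMap s e)
      = inner ℝ (storageMap s θ) (storageMap s e) + ‖storageMap s e‖ ^ 2 := by
    simp only [map_add, inner_add_left, real_inner_self_eq_norm_sq]
  rw [sum_inner_storageRate, sForm_eq_inner hs, ← dotαL_apply, htotal, hdefect, hdot, hstorage]
  ring

end storage

section ellipticForm

variable {d N : ℕ} {m : Medium d N} {D : Discretization m} {ku kp : ℕ} {β cStab cApp h : ℝ}
  {p q r P : Fin N → L2 m.Ω}

namespace Discretization

/-- The product `∏ W_i` of the spaces on which the discrete diffusion forms live. -/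
def energySpace (D : Discretization m) : Submodule ℝ (Fin N → L2 m.Ω) :=
  Submodule.pi univ fun i => (D.net i).W

/-- The discrete pressure space `∏ Q_{i,h}`. -/
def pressureSpace (D : Discretization m) : Submodule ℝ (Fin N → L2 m.Ω) :=
  Submodule.pi univ fun i => (D.net i).Qh

lemma mem_energySpace : p ∈ D.energySpace ↔ ∀ i, p i ∈ (D.net i).W := by
  simp [energySpace]

lemma mem_pressureSpace : p ∈ D.pressureSpace ↔ ∀ i, p i ∈ (D.net i).Qh := by
  simp [pressureSpace]

lemma Mem.p_mem_pressureSpace {X : State m} (hX : D.Mem X) : X.p ∈ D.pressureSpace :=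
  mem_pressureSpace.2 hX.p_mem

lemma pressureSpace_le : D.pressureSpace ≤ D.energySpace :=
  Submodule.pi_mono fun i _ => (D.net i).Qh_le

lemma aForm_add_left (hm : m.HasBoundedCoefficients) (hp : p ∈ D.energySpace)
    (hq : q ∈ D.energySpace) (hr : r ∈ D.energySpace) :
    D.aForm (p + q) r = D.aForm p r + D.aForm q r := by
  rw [mem_energySpace] at hp hq hr
  simp only [aForm, ← Finset.sum_add_distrib]
  refine Finset.sum_congr rfl fun i _ => ?_
  rw [transferForm_eq_inner hm.ξ_memLp, transferForm_eq_inner hm.ξ_memLp,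
    transferForm_eq_inner hm.ξ_memLp, map_add, Pi.add_apply, Pi.add_apply, inner_add_left,
    (D.net i).a_add _ (hp i) _ (hq i) _ (hr i)]
  ring

lemma aForm_smul_left (hm : m.HasBoundedCoefficients) (c : ℝ) (hp : p ∈ D.energySpace)
    (hr : r ∈ D.energySpace) : D.aForm (c • p) r = c * D.aForm p r := by
  rw [mem_energySpace] at hp hr
  simp only [aForm, Finset.mul_sum, mul_add]
  refine Finset.sum_congr rfl fun i _ => ?_
  rw [transferForm_eq_inner hm.ξ_memLp, transferForm_eq_inner hm.ξ_memLp, map_smul, Pi.smul_apply,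
    Pi.smul_apply, real_inner_smul_left, (D.net i).a_smul c _ (hp i) _ (hr i)]

lemma aForm_sub_left (hm : m.HasBoundedCoefficients) (hp : p ∈ D.energySpace)
    (hq : q ∈ D.energySpace) (hr : r ∈ D.energySpace) :
    D.aForm (p - q) r = D.aForm p r - D.aForm q r := by
  rw [sub_eq_add_neg, ← neg_one_smul ℝ q,
    aForm_add_left hm hp (Submodule.smul_mem _ _ hq) hr, aForm_smul_left hm _ hq hr]
  ring

lemma sum_energy_sq_le (hm : m.HasBoundedCoefficients) (hc : 0 ≤ cStab)
    (hD : D.Admissible ku kp β cStab cApp h) (hq : q ∈ D.pressureSpace) :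
    ∑ i, (D.net i).energy (q i) ^ 2 ≤ cStab * D.aForm q q := by
  rw [mem_pressureSpace] at hq
  have htransfer : 0 ≤ ∑ i, transferForm m.ξ i q (q i) := by
    simpa only [transferForm_eq_inner hm.ξ_memLp] using
      sum_inner_transferOp_self_nonneg hm.ξ_memLp hm.ξ_nonneg hm.ξ_symm q
  calc ∑ i, (D.net i).energy (q i) ^ 2 ≤ ∑ i, cStab * (D.net i).a (q i) (q i) :=
        Finset.sum_le_sum fun i _ => (hD.net_adm i).coercive _ (hq i)
    _ = cStab * ∑ i, (D.net i).a (q i) (q i) := (Finset.mul_sum ..).symm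
    _ ≤ cStab * D.aForm q q := by
        rw [aForm, Finset.sum_add_distrib]
        gcongr
        linarith

lemma aForm_self_nonneg (hm : m.HasBoundedCoefficients) (hc : 0 < cStab)
    (hD : D.Admissible ku kp β cStab cApp h) (hq : q ∈ D.pressureSpace) : 0 ≤ D.aForm q q :=
  nonneg_of_mul_nonneg_right
    ((Finset.sum_nonneg fun _ _ => sq_nonneg _).trans (sum_energy_sq_le hm hc.le hD hq)) hc

lemma energy_le_sqrt_aForm (hm : m.HasBoundedCoefficients) (hc : 0 ≤ cStab)
    (hD : D.Admissible ku kp β cStab cApp h) (hq : q ∈ D.pressureSpace) (i : Fin N) :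
    (D.net i).energy (q i) ≤ Real.sqrt (cStab * D.aForm q q) :=
  Real.le_sqrt_of_sq_le <|
    (Finset.single_le_sum (fun j _ => sq_nonneg ((D.net j).energy (q j)))
      (Finset.mem_univ i)).trans (sum_energy_sq_le hm hc hD hq)

lemma norm_le_of_energy_le (hc : 0 ≤ cStab) (hD : D.Admissible ku kp β cStab cApp h)
    (hp : p ∈ D.energySpace) {ρ : ℝ} (hρ0 : 0 ≤ ρ) (hρ : ∀ i, (D.net i).energy (p i) ≤ ρ) :
    ‖p‖ ≤ cStab * ρ := by
  refine (pi_norm_le_iff_of_nonneg (by positivity)).2 fun i => ?_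
  exact ((hD.net_adm i).poincare _ (mem_energySpace.1 hp i)).trans (by gcongr; exact hρ i)

lemma aForm_le (hm : m.HasBoundedCoefficients) (hc : 0 ≤ cStab)
    (hD : D.Admissible ku kp β cStab cApp h) (hp : p ∈ D.energySpace) (hq : q ∈ D.pressureSpace)
    {ρ E : ℝ} (hρ0 : 0 ≤ ρ) (hE0 : 0 ≤ E) (hρ : ∀ i, (D.net i).energy (p i) ≤ ρ)
    (hE : ∀ i, (D.net i).energy (q i) ≤ E) :
    D.aForm p q ≤ N * (‖transferOp hm.ξ_memLp‖ * cStab ^ 2 + cStab) * ρ * E := by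
  have hnet (i : Fin N) : transferForm m.ξ i p (q i) + (D.net i).a (p i) (q i)
      ≤ (‖transferOp hm.ξ_memLp‖ * cStab ^ 2 + cStab) * ρ * E := by
    have htransfer : transferForm m.ξ i p (q i)
        ≤ ‖transferOp hm.ξ_memLp‖ * (cStab * ρ) * (cStab * E) := by
      rw [transferForm_eq_inner hm.ξ_memLp]
      refine (real_inner_le_norm _ _).trans ?_
      gcongr
      · refine (norm_le_pi_norm _ i).trans ((ContinuousLinearMap.le_opNorm _ _).trans ?_)
        gcongr
        exact norm_le_of_energy_le hc hD hp hρ0 hρ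
      · exact (norm_le_pi_norm q i).trans
          (norm_le_of_energy_le hc hD (pressureSpace_le hq) hE0 hE)
    have hdiffusion : (D.net i).a (p i) (q i) ≤ cStab * ρ * E := by
      refine ((le_abs_self _).trans ((hD.net_adm i).bounded _ (mem_energySpace.1 hp i) _
        (mem_pressureSpace.1 hq i))).trans ?_
      gcongr
      · exact (D.net i).energy_nonneg _ (mem_energySpace.1 (pressureSpace_le hq) i)
      · exact hρ i
      · exact hE i
    linarith
  calc D.aForm p q ≤ ∑ _i : Fin N, (‖transferOp hm.ξ_memLp‖ * cStab ^ 2 + cStab) * ρ * E :=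
        Finset.sum_le_sum fun i _ => hnet i
    _ = N * (‖transferOp hm.ξ_memLp‖ * cStab ^ 2 + cStab) * ρ * E := by simp [mul_assoc]

end Discretization

/-- The `L²` quasi-optimality constant of the elliptic projection, see
`Discretization.norm_sub_ellipticProjection_le`. -/
def Medium.HasBoundedCoefficients.ellipticConst (hm : m.HasBoundedCoefficients) (cStab : ℝ) : ℝ :=
  cStab * (1 + cStab * (N * (‖transferOp hm.ξ_memLp‖ * cStab ^ 2 + cStab)))

lemma Medium.HasBoundedCoefficients.ellipticConst_nonneg (hm : m.HasBoundedCoefficients)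
    (hcStab : 0 ≤ cStab) : 0 ≤ hm.ellipticConst cStab := by
  rw [ellipticConst]
  positivity

lemma Discretization.norm_sub_ellipticProjection_le (hm : m.HasBoundedCoefficients)
    (hc : 0 < cStab) (hD : D.Admissible ku kp β cStab cApp h) (hp : p ∈ D.energySpace)
    (hP : P ∈ D.pressureSpace) (hproj : ∀ r ∈ D.pressureSpace, D.aForm P r = D.aForm p r)
    (hq : q ∈ D.pressureSpace) {ρ : ℝ} (hρ0 : 0 ≤ ρ)
    (hρ : ∀ i, (D.net i).energy (p i - q i) ≤ ρ) :
    ‖p - P‖ ≤ hm.ellipticConst cStab * ρ := by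
  set b := N * (‖transferOp hm.ξ_memLp‖ * cStab ^ 2 + cStab)
  have hPq : P - q ∈ D.pressureSpace := sub_mem hP hq
  have hpq : p - q ∈ D.energySpace := sub_mem hp (pressureSpace_le hq)
  set E := Real.sqrt (cStab * D.aForm (P - q) (P - q)) with hE
  have hE0 : 0 ≤ E := Real.sqrt_nonneg _
  have horth : D.aForm (P - q) (P - q) = D.aForm (p - q) (P - q) := by
    rw [aForm_sub_left hm (pressureSpace_le hP) (pressureSpace_le hq) (pressureSpace_le hPq),
      aForm_sub_left hm hp (pressureSpace_le hq) (pressureSpace_le hPq), hproj _ hPq]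
  have henergy (i : Fin N) : (D.net i).energy ((P - q) i) ≤ E :=
    energy_le_sqrt_aForm hm hc.le hD hPq i
  have hE_sq : E * E ≤ cStab * b * ρ * E := by
    rw [hE, Real.mul_self_sqrt (mul_nonneg hc.le (aForm_self_nonneg hm hc hD hPq)), ← hE, horth]
    linarith [mul_le_mul_of_nonneg_left (aForm_le hm hc.le hD hpq hPq hρ0 hE0 hρ henergy) hc.le]
  have hE_le : E ≤ cStab * b * ρ := by
    rcases hE0.eq_or_lt with h0 | hpos
    · rw [← h0]; positivity
    · exact le_of_mul_le_mul_right hE_sq hpos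
  calc ‖p - P‖ = ‖(p - q) - (P - q)‖ := by rw [sub_sub_sub_cancel_right]
    _ ≤ ‖p - q‖ + ‖P - q‖ := norm_sub_le _ _
    _ ≤ cStab * ρ + cStab * (cStab * b * ρ) := by
        gcongr
        · exact norm_le_of_energy_le hc.le hD hpq hρ0 hρ
        · exact (norm_le_of_energy_le hc.le hD (pressureSpace_le hPq) hE0 henergy).trans
            (by gcongr)
    _ = hm.ellipticConst cStab * ρ := by rw [Medium.HasBoundedCoefficients.ellipticConst]; ring

end ellipticForm

/-! ### The exact solution -/

section exactSolution

variable {d N : ℕ} {m : Medium d N} {D : Discretization m} {s : Fin N → ℝ} {lam T M t : ℝ}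
  {ku kp : ℕ} {β cStab cApp h : ℝ} {f : ℝ → Fin d → L2 m.Ω} {g : ℝ → Fin N → L2 m.Ω}
  {u0 : Fin d → H1 m.Ω} {pt0 : L2 m.Ω} {p0 : Fin N → H1 m.Ω}
  {u : ℝ → Fin d → H1 m.Ω} {pt : ℝ → L2 m.Ω} {p : ℝ → Fin N → H1 m.Ω}

/-- The time derivatives of the network pressures and of the total pressure. -/
def pressureRate {Ω : Set (Pt d)} (T : ℝ) (pt : ℝ → L2 Ω) (p : ℝ → Fin N → H1 Ω) (t : ℝ) :
    (Fin N → L2 Ω) × L2 Ω :=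
  (fun i => dt T (fun τ => fn (p τ i)) t, dt T pt t)

/-- The functions `F_i ∈ L²(Ω)` with `-div (K_i ∇p_i) = F_i` at time `t`. -/
def fluxSource (hm : m.HasBoundedCoefficients) (s : Fin N → ℝ) (lam T : ℝ)
    (g : ℝ → Fin N → L2 m.Ω) (pt : ℝ → L2 m.Ω) (p : ℝ → Fin N → H1 m.Ω) (t : ℝ) : Fin N → L2 m.Ω :=
  g t - storageRate s m.α lam (pressureRate T pt p t)
    - transferOp hm.ξ_memLp (fun i => fn (p t i))

lemma IsRegular.continuousOn_pressureRate (hr : IsRegular ku kp T M u pt p) (hT : 0 < T) :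
    ContinuousOn (pressureRate T pt p) (Icc 0 T) := by
  have hu : UniqueDiffOn ℝ (Icc 0 T) := uniqueDiffOn_Icc hT
  exact (continuousOn_pi.2 fun i =>
    (hr.p_smooth i).continuousOn_derivWithin hu (by norm_num)).prodMk
      (hr.pt_smooth.continuousOn_derivWithin hu (by norm_num))

lemma IsRegular.continuousOn_fluxSource (hr : IsRegular ku kp T M u pt p)
    (hm : m.HasBoundedCoefficients) (hT : 0 < T) (hg : ContinuousOn g (Icc 0 T)) :
    ContinuousOn (fluxSource hm s lam T g pt p) (Icc 0 T) :=
  (hg.sub ((storageRate s m.α lam).continuous.comp_continuousOn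
    (hr.continuousOn_pressureRate hT))).sub
      ((transferOp hm.ξ_memLp).continuous.comp_continuousOn
        (continuousOn_pi.2 fun i => (hr.p_smooth i).continuousOn))

/-- The equations are only required on `(0, T]`; they extend to `t = 0` by continuity. -/
lemma IsSolution.diffusionForm_eq (hs : IsSolution m s lam T f g u0 pt0 p0 u pt p)
    (hr : IsRegular ku kp T M u pt p) (hm : m.HasBoundedCoefficients) (hT : 0 < T)
    (hg : ContinuousOn g (Icc 0 T)) (ht : t ∈ Icc 0 T) (i : Fin N) {q : H1 m.Ω}
    (hq : q ∈ H1zero m.Ω (frontier m.Ω)) :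
    diffusionForm (m.K i) (p t i) q = inner ℝ (fluxSource hm s lam T g pt p t i) (fn q) := by
  have hflux : ContinuousOn (fun t => fluxSource hm s lam T g pt p t i) (Icc 0 T) :=
    (continuous_apply i).comp_continuousOn (hr.continuousOn_fluxSource hm hT hg)
  have hform : ContinuousOn (fun t => diffusionForm (m.K i) (p t i) q) (Icc 0 T) :=
    (continuous_diffusionForm_left (hm.K_memLp i) q).comp_continuousOn
      ((continuous_apply i).comp_continuousOn hs.p_cont)
  refine EqOn.of_subset_closure (s := Ioc 0 T) (t := Icc 0 T) (fun t ht => ?_) hform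
    (hflux.inner continuousOn_const) Ioc_subset_Icc_self (closure_Ioc hT.ne).ge ht
  have hdiffusion := hs.diffusion t ht i q hq
  rw [transferForm_eq_inner hm.ξ_memLp] at hdiffusion
  simp only [fluxSource, pressureRate, Pi.sub_apply, inner_sub_left, storageRate_apply]
  linarith

lemma IsSolution.discrete_consistency (hs : IsSolution m s lam T f g u0 pt0 p0 u pt p)
    (hr : IsRegular ku kp T M u pt p) (hm : m.HasBoundedCoefficients) (hT : 0 < T)
    (hg : ContinuousOn g (Icc 0 T)) (hD : D.Admissible ku kp β cStab cApp h) (ht : t ∈ Icc 0 T)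
    (i : Fin N) :
    fn (p t i) ∈ (D.net i).W ∧ ∀ q ∈ (D.net i).Qh,
      (D.net i).a (fn (p t i)) q = inner ℝ (fluxSource hm s lam T g pt p t i) q :=
  (hD.net_adm i).consistent (p t i) (hs.p_mem t ht i) (hr.p_mem t ht i) _
    fun _ hq => hs.diffusionForm_eq hr hm hT hg ht i hq

lemma IsSolution.aForm_eq (hs : IsSolution m s lam T f g u0 pt0 p0 u pt p)
    (hr : IsRegular ku kp T M u pt p) (hm : m.HasBoundedCoefficients) (hT : 0 < T)
    (hg : ContinuousOn g (Icc 0 T)) (hD : D.Admissible ku kp β cStab cApp h) (ht : t ∈ Icc 0 T)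
    {q : Fin N → L2 m.Ω} (hq : q ∈ D.pressureSpace) :
    D.aForm (fun i => fn (p t i)) q
      = ∑ i, inner ℝ ((g t - storageRate s m.α lam (pressureRate T pt p t)) i) (q i) := by
  refine Finset.sum_congr rfl fun i _ => ?_
  rw [(hs.discrete_consistency hr hm hT hg hD ht i).2 _ (Discretization.mem_pressureSpace.1 hq i),
    transferForm_eq_inner hm.ξ_memLp, fluxSource, Pi.sub_apply (g t - _), inner_sub_left]
  ring

lemma Discretization.IsMonolithicStep.aForm_midpoint_eq {τ : ℝ} {f1 : Fin d → L2 m.Ω}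
    {g0 g1 : Fin N → L2 m.Ω} {X0h X1h : State m}
    (hX : D.IsMonolithicStep s lam τ f1 g0 g1 X0h X1h) {q : Fin N → L2 m.Ω}
    (hq : q ∈ D.pressureSpace) :
    D.aForm ((1 / 2 : ℝ) • (X0h.p + X1h.p)) q
      = ∑ i, inner ℝ (((1 / 2 : ℝ) • (g0 + g1)
          - storageRate s m.α lam (τ⁻¹ • (X1h.p - X0h.p, X1h.pt - X0h.pt))) i) (q i) := by
  refine Finset.sum_congr rfl fun i _ => ?_
  have hstep := hX.diffusion i (q i) (Discretization.mem_pressureSpace.1 hq i)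
  rw [Prod.smul_mk, Pi.sub_apply, inner_sub_left, storageRate_apply, inner_add_left]
  simp only [Pi.smul_apply, Pi.add_apply, Pi.sub_apply] at hstep ⊢
  linarith

end exactSolution

section pressureError

variable {d N : ℕ} {m : Medium d N} {D : Discretization m} {s : Fin N → ℝ} {lam T M τ : ℝ}
  {ku kp : ℕ} {β cStab cApp h : ℝ} {f : ℝ → Fin d → L2 m.Ω} {g : ℝ → Fin N → L2 m.Ω}
  {u0 : Fin d → H1 m.Ω} {pt0 : L2 m.Ω} {p0 : Fin N → H1 m.Ω}
  {u : ℝ → Fin d → H1 m.Ω} {pt : ℝ → L2 m.Ω} {p : ℝ → Fin N → H1 m.Ω} {P0 P1 X0h X1h : State m}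

lemma IsSolution.aForm_step_error (hs : IsSolution m s lam T f g u0 pt0 p0 u pt p)
    (hr : IsRegular ku kp T M u pt p) (hm : m.HasBoundedCoefficients) (hτ : 0 < τ) (hτT : τ ≤ T)
    (hg : ContinuousOn g (Icc 0 T)) (hD : D.Admissible ku kp β cStab cApp h)
    (hP0 : D.IsProjection lam (stateAt u pt p 0) P0)
    (hP1 : D.IsProjection lam (stateAt u pt p τ) P1) (hp : X0h.p = P0.p) {f1 : Fin d → L2 m.Ω}
    (hX : D.IsMonolithicStep s lam τ f1 (g 0) (g τ) X0h X1h) {q : Fin N → L2 m.Ω}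
    (hq : q ∈ D.pressureSpace) :
    τ / 2 * D.aForm (P1.p - X1h.p) q
      = -∑ i, inner ℝ (storageRate s m.α lam
          ((τ / 2) • (pressureRate T pt p 0 + pressureRate T pt p τ)
            - (X1h.p - X0h.p, X1h.pt - X0h.pt)) i) (q i) := by
  have hT : 0 < T := hτ.trans_le hτT
  have hP0s := Discretization.pressureSpace_le hP0.mem.p_mem_pressureSpace
  have hP1s := Discretization.pressureSpace_le hP1.mem.p_mem_pressureSpace
  have hX1s := Discretization.pressureSpace_le hX.mem.p_mem_pressureSpace
  have hqs := Discretization.pressureSpace_le hq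
  have hexact0 := (hP0.elliptic q (Discretization.mem_pressureSpace.1 hq)).trans
    (hs.aForm_eq hr hm hT hg hD ⟨le_rfl, hT.le⟩ hq)
  have hexact1 := (hP1.elliptic q (Discretization.mem_pressureSpace.1 hq)).trans
    (hs.aForm_eq hr hm hT hg hD ⟨hτ.le, hτT⟩ hq)
  have hstep := hX.aForm_midpoint_eq hq
  rw [hp, Discretization.aForm_smul_left hm _ (add_mem hP0s hX1s) hqs,
    Discretization.aForm_add_left hm hP0s hX1s hqs] at hstep
  rw [Discretization.aForm_sub_left hm hP1s hX1s hqs]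
  have hscale : τ • τ⁻¹ • (X1h.p - P0.p, X1h.pt - X0h.pt) = (X1h.p - P0.p, X1h.pt - X0h.pt) :=
    smul_inv_smul₀ hτ.ne' _
  rw [hp, ← hscale, map_sub, map_smul, map_smul, map_add]
  simp only [Pi.sub_apply, Pi.smul_apply, Pi.add_apply, inner_sub_left, inner_add_left,
    real_inner_smul_left, Finset.sum_sub_distrib, Finset.sum_add_distrib, ← Finset.mul_sum]
    at hexact0 hexact1 hstep ⊢
  linear_combination (τ / 2) * hexact0 + (τ / 2) * hexact1 - τ * hstep

end pressureError

/-! ### Energy estimate of the step -/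

section stepError

variable {d N : ℕ} {m : Medium d N} {D : Discretization m} {s : Fin N → ℝ} {lam T M τ : ℝ}
  {ku kp : ℕ} {β cStab cApp h : ℝ} {f : ℝ → Fin d → L2 m.Ω} {g : ℝ → Fin N → L2 m.Ω}
  {u0 : Fin d → H1 m.Ω} {pt0 : L2 m.Ω} {p0 : Fin N → H1 m.Ω}
  {u : ℝ → Fin d → H1 m.Ω} {pt : ℝ → L2 m.Ω} {p : ℝ → Fin N → H1 m.Ω}
  {f1 : Fin d → L2 m.Ω} {g0 g1 : Fin N → L2 m.Ω} {X P P0 P1 X0h X1h : State m}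

lemma Discretization.IsProjection.isSaddleProjection (hP : D.IsProjection lam X P)
    (hμ : 0 ≤ m.μ) :
    IsSaddleProjection (strainMap m.μ) divMap D.Vh D.Qth lam⁻¹ X.u X.pt P.u P.pt where
  left_mem := hP.mem.u_mem
  right_mem := hP.mem.pt_mem
  left_eq v hv := by
    simpa only [elasticForm_eq_inner hμ, divMap_apply] using hP.lame₁ v hv
  right_eq q hq := hP.lame₂ q hq

lemma Discretization.IsMonolithicStep.elasticity_eq
    (hX : D.IsMonolithicStep s lam τ f1 g0 g1 X0h X1h) (hS : SolvesStokes m lam f1 X.u X.pt X.p)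
    (hμ : 0 ≤ m.μ) (hV : D.Vh ≤ V m.Ω m.Γd) {v : Fin d → H1 m.Ω} (hv : v ∈ D.Vh) :
    inner ℝ (strainMap m.μ X1h.u) (strainMap m.μ v) - inner ℝ X1h.pt (divMap v)
      = inner ℝ (strainMap m.μ X.u) (strainMap m.μ v) - inner ℝ X.pt (divMap v) := by
  simpa only [elasticForm_eq_inner hμ, divMap_apply] using
    (hX.elasticity v hv).trans (hS.1 v (hV hv)).symm

lemma SolvesStokes.inner_strain_error (hS : SolvesStokes m lam f1 X.u X.pt X.p) (hμ : 0 ≤ m.μ)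
    (hV : D.Vh ≤ V m.Ω m.Γd) (hP : D.IsProjection lam X P)
    (hX : D.IsMonolithicStep s lam τ f1 g0 g1 X0h X1h) {v : Fin d → H1 m.Ω} (hv : v ∈ D.Vh) :
    inner ℝ (strainMap m.μ (P.u - X1h.u)) (strainMap m.μ v)
      = inner ℝ (P.pt - X1h.pt) (divMap v) :=
  (hP.isSaddleProjection hμ).inner_left_sub (fun _ hw => hX.elasticity_eq hS hμ hV hw) hv

lemma SolvesStokes.norm_totalPressure_error_le (hS : SolvesStokes m lam f1 X.u X.pt X.p)
    (hμ : 0 < m.μ) (hβ : 0 < β) (hD : D.Admissible ku kp β cStab cApp h)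
    (hP : D.IsProjection lam X P) (hX : D.IsMonolithicStep s lam τ f1 g0 g1 X0h X1h) :
    ‖P.pt - X1h.pt‖ ≤ Real.sqrt (2 * m.μ) / β * ‖strainMap m.μ (P.u - X1h.u)‖ :=
  (hD.infSup hμ hβ).norm_le (sub_mem hP.mem.pt_mem hX.mem.pt_mem)
    fun _ hv => hS.inner_strain_error hμ.le hD.Vh_le hP hX hv

lemma SolvesStokes.energy_identity (hS : SolvesStokes m lam f1 X.u X.pt X.p) (hμ : 0 ≤ m.μ)
    (hV : D.Vh ≤ V m.Ω m.Γd) (hP : D.IsProjection lam X P)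
    (hX : D.IsMonolithicStep s lam τ f1 g0 g1 X0h X1h) :
    ‖strainMap m.μ (P.u - X1h.u)‖ ^ 2 + lam⁻¹ * ‖P.pt - X1h.pt‖ ^ 2
      = lam⁻¹ * inner ℝ (dotαL m.α (P.p - X1h.p) + dotαL m.α (X.p - P.p)) (P.pt - X1h.pt) := by
  have hdot : dotαL m.α (P.p - X1h.p) + dotαL m.α (X.p - P.p)
      = dotα m.α X.p - dotα m.α X1h.p := by
    rw [← map_add, add_comm, sub_add_sub_cancel, map_sub, dotαL_apply, dotαL_apply]
  have hpressure (q : L2 m.Ω) (hq : q ∈ D.Qth) :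
      -inner ℝ (divMap X1h.u) q - lam⁻¹ * inner ℝ X1h.pt q
        = -inner ℝ (divMap X.u) q - lam⁻¹ * inner ℝ X.pt q
          + lam⁻¹ * inner ℝ (dotα m.α X.p - dotα m.α X1h.p) q := by
    simp only [inner_sub_left, divMap_apply]
    linarith [hX.totalPressure q hq, hS.2 q]
  rw [hdot]
  exact (hP.isSaddleProjection hμ).norm_sq_sub_eq hX.mem.u_mem hX.mem.pt_mem
    (fun _ hw => hX.elasticity_eq hS hμ hV hw) hpressure

/-- The defect `θ` of the network pressures: the trapezoidal increment of the exact pressures minus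
the increment of their projections. -/
def networkDefect (T τ : ℝ) (p : ℝ → Fin N → H1 m.Ω) (P0 P1 : State m) : Fin N → L2 m.Ω :=
  (fun i => trapezoid 0 T τ fun t => fn (p t i)) - (P1.p - P0.p)

/-- The defect `ψ` of the total pressure. It starts from the discrete value `X0h.pt`, which is not
the projection of the exact one, so that the initial error does not appear separately. -/
def totalDefect (T τ : ℝ) (pt : ℝ → L2 m.Ω) (P1 X0h : State m) : L2 m.Ω :=
  trapezoid 0 T τ pt - (P1.pt - X0h.pt)

lemma trapezoid_increment_sub_eq (hp : X0h.p = P0.p) :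
    (τ / 2) • (pressureRate T pt p 0 + pressureRate T pt p τ)
        - (X1h.p - X0h.p, X1h.pt - X0h.pt)
      = (networkDefect T τ p P0 P1 + (P1.p - X1h.p),
          totalDefect T τ pt P1 X0h + (P1.pt - X1h.pt)) := by
  have hnet : (τ / 2) • (pressureRate T pt p 0 + pressureRate T pt p τ)
      = (fun i => trapezoid 0 T τ fun t => fn (p t i), trapezoid 0 T τ pt) := by
    simp only [trapezoid, sub_zero]
    rfl
  rw [hnet, hp, networkDefect, totalDefect, Prod.mk_sub_mk]
  congr 1 <;> abel

lemma IsSolution.pressure_energy_identity (hs : IsSolution m s lam T f g u0 pt0 p0 u pt p)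
    (hr : IsRegular ku kp T M u pt p) (hm : m.HasBoundedCoefficients) (hs0 : ∀ i, 0 ≤ s i)
    (hτ : 0 < τ) (hτT : τ ≤ T) (hg : ContinuousOn g (Icc 0 T))
    (hD : D.Admissible ku kp β cStab cApp h) (hP0 : D.IsProjection lam (stateAt u pt p 0) P0)
    (hP1 : D.IsProjection lam (stateAt u pt p τ) P1) (hp : X0h.p = P0.p)
    (hX : D.IsMonolithicStep s lam τ f1 (g 0) (g τ) X0h X1h) :
    ‖storageMap s (P1.p - X1h.p)‖ ^ 2 + lam⁻¹ * ‖dotαL m.α (P1.p - X1h.p)‖ ^ 2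
        - lam⁻¹ * inner ℝ (P1.pt - X1h.pt) (dotαL m.α (P1.p - X1h.p))
        + τ / 2 * D.aForm (P1.p - X1h.p) (P1.p - X1h.p)
      = lam⁻¹ * inner ℝ (totalDefect T τ pt P1 X0h - dotαL m.α (networkDefect T τ p P0 P1))
          (dotαL m.α (P1.p - X1h.p))
        - inner ℝ (storageMap s (networkDefect T τ p P0 P1)) (storageMap s (P1.p - X1h.p)) := by
  rw [hs.aForm_step_error hr hm hτ hτT hg hD hP0 hP1 hp hX
    (sub_mem hP1.mem.p_mem_pressureSpace hX.mem.p_mem_pressureSpace),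
    trapezoid_increment_sub_eq (P1 := P1) hp, sum_inner_storageRate_add_self hs0]
  ring

lemma IsSolution.step_error_energy_le (hs : IsSolution m s lam T f g u0 pt0 p0 u pt p)
    (hr : IsRegular ku kp T M u pt p) (hm : m.HasBoundedCoefficients) (hs0 : ∀ i, 0 ≤ s i)
    (hlam : 0 ≤ lam) (hβ : 0 < β) (hτ : 0 < τ) (hτT : τ ≤ T) (hg : ContinuousOn g (Icc 0 T))
    (hD : D.Admissible ku kp β cStab cApp h) (hP0 : D.IsProjection lam (stateAt u pt p 0) P0)
    (hP1 : D.IsProjection lam (stateAt u pt p τ) P1) (hp : X0h.p = P0.p)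
    (hX : D.IsMonolithicStep s lam τ (f τ) (g 0) (g τ) X0h X1h) :
    ‖strainMap m.μ (P1.u - X1h.u)‖ ^ 2 + ‖storageMap s (P1.p - X1h.p)‖ ^ 2
        + lam⁻¹ * ‖(P1.pt - X1h.pt) - dotαL m.α (P1.p - X1h.p)‖ ^ 2
        + 2 * (τ / 2 * D.aForm (P1.p - X1h.p) (P1.p - X1h.p))
      ≤ lam⁻¹ ^ 2 * (Real.sqrt (2 * m.μ) / β) ^ 2
          * ‖dotαL m.α ((stateAt u pt p τ).p - P1.p)
            + (totalDefect T τ pt P1 X0h - dotαL m.α (networkDefect T τ p P0 P1))‖ ^ 2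
        + lam⁻¹ * ‖totalDefect T τ pt P1 X0h - dotαL m.α (networkDefect T τ p P0 P1)‖ ^ 2
        + ‖storageMap s (networkDefect T τ p P0 P1)‖ ^ 2 := by
  have hμ := hm.μ_pos
  have hS : SolvesStokes m lam (f τ) (stateAt u pt p τ).u (stateAt u pt p τ).pt
      (stateAt u pt p τ).p := hs.stokes τ ⟨hτ, hτT⟩
  exact energy_le_of_balances (inv_nonneg.2 hlam)
    (hS.norm_totalPressure_error_le hμ hβ hD hP1 hX)
    (hS.energy_identity hμ.le hD.Vh_le hP1 hX)
    (hs.pressure_energy_identity hr hm hs0 hτ hτT hg hD hP0 hP1 hp hX)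

end stepError

/-! ### Error bounds -/

section projectionError

variable {d N : ℕ} {m : Medium d N} {D : Discretization m} {s : Fin N → ℝ} {lam cLam T M t : ℝ}
  {ku kp : ℕ} {β cStab cApp h : ℝ} {f : ℝ → Fin d → L2 m.Ω} {g : ℝ → Fin N → L2 m.Ω}
  {u0 : Fin d → H1 m.Ω} {pt0 : L2 m.Ω} {p0 : Fin N → H1 m.Ω}
  {u : ℝ → Fin d → H1 m.Ω} {pt : ℝ → L2 m.Ω} {p : ℝ → Fin N → H1 m.Ω} {P : State m}

lemma exists_lt_two_mul_of_ciInf_le {ι : Type*} [Nonempty ι] {F : ι → ℝ} {c x M : ℝ} {k : ℕ}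
    (hc : 0 < c) (hh : 0 < h) (hM : 0 < M) (hx : x ≤ M) (hF : ⨅ i, F i ≤ c * h ^ k * x) :
    ∃ i, F i < 2 * c * M * h ^ k := by
  have hck : 0 < c * h ^ k := by positivity
  have hx' : c * h ^ k * x ≤ c * h ^ k * M := by gcongr
  exact exists_lt_of_ciInf_lt (hF.trans_lt (by linarith [mul_pos hck hM]))

lemma inv_le_div_of_le_mul {μ : ℝ} (hμ : 0 < μ) (hlam : 0 < lam) (h : μ ≤ cLam * lam) :
    lam⁻¹ ≤ cLam / μ := by
  rw [inv_eq_one_div, div_le_div_iff₀ hlam hμ]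
  linarith

/-- The quasi-optimality constant of the projection of the displacement and of the total pressure,
see `Discretization.norm_sub_lameProjection_le`. -/
def Medium.lameConst (m : Medium d N) (cLam β : ℝ) : ℝ :=
  saddleConst (d * (Real.sqrt (2 * m.μ))⁻¹) (Real.sqrt (2 * m.μ) / β) (cLam / m.μ)
    * (1 + Real.sqrt (2 * m.μ))

lemma Medium.lameConst_nonneg (hμ : 0 ≤ m.μ) (hcLam : 0 ≤ cLam) (hβ : 0 ≤ β) :
    0 ≤ m.lameConst cLam β :=
  mul_nonneg (saddleConst_nonneg (by positivity) (by positivity) (by positivity)) (by positivity)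

lemma Discretization.norm_sub_lameProjection_le {X : State m} {v : Fin d → H1 m.Ω} {q : L2 m.Ω}
    {δ : ℝ} (hμ : 0 < m.μ) (hlam : 0 < lam) (hμlam : m.μ ≤ cLam * lam) (hβ : 0 < β)
    (hD : D.Admissible ku kp β cStab cApp h) (hP : D.IsProjection lam X P)
    (hv : v ∈ D.Vh) (hq : q ∈ D.Qth) (hu : vNorm m.μ (X.u - v) ≤ δ)
    (hp : qtNorm m.μ (X.pt - q) ≤ δ) :
    ‖strainMap m.μ (X.u - P.u)‖ ≤ m.lameConst cLam β * δ ∧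
      ‖X.pt - P.pt‖ ≤ m.lameConst cLam β * δ := by
  have hΛ := inv_le_div_of_le_mul hμ hlam hμlam
  have hinv : 0 ≤ lam⁻¹ := inv_nonneg.2 hlam.le
  have hconst := saddleConst_nonneg (κ := d * (Real.sqrt (2 * m.μ))⁻¹)
    (k := Real.sqrt (2 * m.μ) / β) (Λ := cLam / m.μ) (by positivity) (by positivity)
    (hinv.trans hΛ)
  have hnear : ‖strainMap m.μ (X.u - v)‖ + ‖X.pt - q‖ ≤ (1 + Real.sqrt (2 * m.μ)) * δ := by
    rw [← vNorm_eq_norm hμ.le, norm_eq_qtNorm hμ]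
    nlinarith [mul_le_mul_of_nonneg_left hp (Real.sqrt_nonneg (2 * m.μ))]
  have hbound := mul_le_mul_of_nonneg_left hnear hconst
  rw [← mul_assoc] at hbound
  obtain ⟨hPu, hPp⟩ := (hP.isSaddleProjection hμ.le).quasiOptimal (by positivity)
    (norm_divMap_le hμ) (hD.infSup hμ hβ) (by positivity) hinv hΛ hv hq
  exact ⟨hPu.trans hbound, hPp.trans hbound⟩

lemma IsRegular.lameProjection_error_le (hr : IsRegular ku kp T M u pt p)
    (huV : u t ∈ V m.Ω m.Γd) (ht : t ∈ Icc 0 T) (hμ : 0 < m.μ) (hlam : 0 < lam)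
    (hμlam : m.μ ≤ cLam * lam) (hβ : 0 < β) (hcApp : 0 < cApp) (hM : 0 < M) (hh : 0 < h)
    (hD : D.Admissible ku kp β cStab cApp h) (hP : D.IsProjection lam (stateAt u pt p t) P) :
    ‖strainMap m.μ ((stateAt u pt p t).u - P.u)‖ ≤ m.lameConst cLam β * (2 * cApp * M * h ^ ku) ∧
      ‖(stateAt u pt p t).pt - P.pt‖ ≤ m.lameConst cLam β * (2 * cApp * M * h ^ ku) := by
  obtain ⟨v, hv⟩ := exists_lt_two_mul_of_ciInf_le hcApp hh hM (hr.u_le t ht)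
    (hD.Vh_approx (u t) huV (hr.u_mem t ht))
  obtain ⟨q, hq⟩ := exists_lt_two_mul_of_ciInf_le hcApp hh hM (hr.pt_le t ht)
    (hD.Qth_approx (pt t) (hr.pt_mem t ht))
  exact Discretization.norm_sub_lameProjection_le hμ hlam hμlam hβ hD hP v.2 q.2 hv.le hq.le

lemma IsSolution.ellipticProjection_error_le (hs : IsSolution m s lam T f g u0 pt0 p0 u pt p)
    (hr : IsRegular ku kp T M u pt p) (hm : m.HasBoundedCoefficients) (hT : 0 < T)
    (hg : ContinuousOn g (Icc 0 T)) (ht : t ∈ Icc 0 T) (hcStab : 0 < cStab) (hcApp : 0 < cApp)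
    (hM : 0 < M) (hh : 0 < h) (hD : D.Admissible ku kp β cStab cApp h)
    (hP : D.IsProjection lam (stateAt u pt p t) P) :
    ‖(stateAt u pt p t).p - P.p‖ ≤ hm.ellipticConst cStab * (2 * cApp * M * h ^ kp) := by
  have hW (i : Fin N) : fn (p t i) ∈ (D.net i).W :=
    (hs.discrete_consistency hr hm hT hg hD ht i).1
  have happrox (i : Fin N) : ∃ q : (D.net i).Qh,
      (D.net i).energy (fn (p t i) - q.1) < 2 * cApp * M * h ^ kp :=
    exists_lt_two_mul_of_ciInf_le hcApp hh hM (hr.p_le t ht i)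
      ((hD.net_adm i).approx (p t i) (hs.p_mem t ht i) (hr.p_mem t ht i) (hW i))
  choose q hq using happrox
  exact Discretization.norm_sub_ellipticProjection_le hm hcStab hD
    (Discretization.mem_energySpace.2 hW) hP.mem.p_mem_pressureSpace
    (fun r hr => hP.elliptic r (Discretization.mem_pressureSpace.1 hr))
    (Discretization.mem_pressureSpace.2 fun i => (q i).2) (by positivity) fun i => (hq i).le

end projectionError

section errorBounds

variable {d N : ℕ} {m : Medium d N} {D : Discretization m} {s : Fin N → ℝ}
  {lam sMax cLam T M τ δ : ℝ} {ku kp : ℕ} {β cStab cApp cInit h : ℝ} {f : ℝ → Fin d → L2 m.Ω}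
  {g : ℝ → Fin N → L2 m.Ω} {u0 : Fin d → H1 m.Ω} {pt0 : L2 m.Ω} {p0 : Fin N → H1 m.Ω}
  {u : ℝ → Fin d → H1 m.Ω} {pt : ℝ → L2 m.Ω} {p : ℝ → Fin N → H1 m.Ω}
  {f1 : Fin d → L2 m.Ω} {g0 g1 : Fin N → L2 m.Ω} {X Y P P0 P1 X0h X1h : State m}

lemma norm_sub_sq_le_two_mul {E : Type*} [SeminormedAddCommGroup E] (x y : E) :
    ‖x - y‖ ^ 2 ≤ 2 * ‖x‖ ^ 2 + 2 * ‖y‖ ^ 2 := by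
  rw [← mul_add]
  exact (pow_le_pow_left₀ (norm_nonneg _) (norm_sub_le _ _) 2).trans add_sq_le

/-- `‖u‖_V² + ‖p_t‖²_{Q_t} + ‖p‖_S²`, the square of the norm in which the errors are measured. -/
def State.normSq (s : Fin N → ℝ) (lam : ℝ) (X : State m) : ℝ :=
  vNorm m.μ X.u ^ 2 + qtNorm m.μ X.pt ^ 2 + sNorm s m.α lam X.p ^ 2

lemma State.normSq_sub_le (hμ : 0 ≤ m.μ) (hs : ∀ i, 0 ≤ s i) (hlam : 0 ≤ lam) :
    (X - Y).normSq s lam ≤ 2 * X.normSq s lam + 2 * Y.normSq s lam := by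
  have hu : vNorm m.μ (X.u - Y.u) ^ 2 ≤ 2 * vNorm m.μ X.u ^ 2 + 2 * vNorm m.μ Y.u ^ 2 := by
    simpa only [vNorm_eq_norm hμ, map_sub] using norm_sub_sq_le_two_mul _ _
  have hpt : qtNorm m.μ (X.pt - Y.pt) ^ 2
      ≤ 2 * qtNorm m.μ X.pt ^ 2 + 2 * qtNorm m.μ Y.pt ^ 2 := by
    simp only [qtNorm_eq, mul_pow]
    linarith [mul_le_mul_of_nonneg_left (norm_sub_sq_le_two_mul X.pt Y.pt)
      (sq_nonneg (Real.sqrt (2 * m.μ))⁻¹)]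
  have hp : sNorm s m.α lam (X.p - Y.p) ^ 2
      ≤ 2 * sNorm s m.α lam X.p ^ 2 + 2 * sNorm s m.α lam Y.p ^ 2 := by
    simp only [sNorm_sq hs hlam, map_sub]
    linarith [norm_sub_sq_le_two_mul (storageMap s X.p) (storageMap s Y.p),
      mul_le_mul_of_nonneg_left (norm_sub_sq_le_two_mul (dotαL m.α X.p) (dotαL m.α Y.p))
        (inv_nonneg.2 hlam)]
  have hsub : (X - Y).normSq s lam = vNorm m.μ (X.u - Y.u) ^ 2 + qtNorm m.μ (X.pt - Y.pt) ^ 2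
    + sNorm s m.α lam (X.p - Y.p) ^ 2 := rfl
  rw [hsub, State.normSq, State.normSq]
  linarith

lemma State.norm_add_norm_add_norm_le {c η : ℝ} (hc : 0 ≤ c) (hη : 0 ≤ η)
    (hX : X.normSq s lam ≤ c * η ^ 2) :
    vNorm m.μ X.u + qtNorm m.μ X.pt + sNorm s m.α lam X.p ≤ 3 * (1 + c) * η := by
  have hle {x : ℝ} (hx : x ^ 2 ≤ X.normSq s lam) : x ≤ (1 + c) * η := by
    refine (le_abs_self x).trans (abs_le_of_sq_le_sq ?_ (by positivity))
    linarith [mul_nonneg (by positivity : 0 ≤ 1 + c + c ^ 2) (sq_nonneg η)]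
  have hu := sq_nonneg (vNorm m.μ X.u)
  have hpt := sq_nonneg (qtNorm m.μ X.pt)
  have hp := sq_nonneg (sNorm s m.α lam X.p)
  have hvNorm := hle (x := vNorm m.μ X.u) (by rw [State.normSq]; linarith)
  have hqtNorm := hle (x := qtNorm m.μ X.pt) (by rw [State.normSq]; linarith)
  have hsNorm := hle (x := sNorm s m.α lam X.p) (by rw [State.normSq]; linarith)
  linarith

lemma mul_norm_sq_le_of_norm_le {E : Type*} [SeminormedAddCommGroup E] {t r : E} {l k Λ x : ℝ}
    (hl : 0 ≤ l) (hlΛ : l ≤ Λ) (ht : ‖t‖ ≤ k * x) :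
    l * ‖r‖ ^ 2 ≤ 2 * (l * ‖t - r‖ ^ 2) + 2 * (Λ * k ^ 2) * x ^ 2 := by
  have hr : ‖r‖ ^ 2 ≤ 2 * ‖t‖ ^ 2 + 2 * ‖t - r‖ ^ 2 := by
    simpa only [sub_sub_cancel] using norm_sub_sq_le_two_mul t (t - r)
  have hΛ : 0 ≤ Λ := hl.trans hlΛ
  have ht_sq : l * ‖t‖ ^ 2 ≤ Λ * (k * x) ^ 2 := by gcongr
  linarith [mul_le_mul_of_nonneg_left hr hl]

lemma State.normSq_le_energy (hs : ∀ i, 0 ≤ s i) (hμ : 0 < m.μ) (hlam : 0 < lam)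
    (hμlam : m.μ ≤ cLam * lam) (hcLam : 0 ≤ cLam)
    (hpt : ‖X.pt‖ ≤ Real.sqrt (2 * m.μ) / β * ‖strainMap m.μ X.u‖) :
    X.normSq s lam ≤ (2 + (1 + 4 * cLam) / β ^ 2) * (‖strainMap m.μ X.u‖ ^ 2
      + ‖storageMap s X.p‖ ^ 2 + lam⁻¹ * ‖X.pt - dotαL m.α X.p‖ ^ 2) := by
  have hinv : 0 ≤ lam⁻¹ := inv_nonneg.2 hlam.le
  have hqt : qtNorm m.μ X.pt ≤ 1 / β * ‖strainMap m.μ X.u‖ := by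
    rw [qtNorm_eq, inv_mul_le_iff₀ (Real.sqrt_pos.2 (by positivity))]
    exact hpt.trans_eq (by ring)
  have hqt_sq : qtNorm m.μ X.pt ^ 2 ≤ (1 / β * ‖strainMap m.μ X.u‖) ^ 2 :=
    pow_le_pow_left₀ (Real.sqrt_nonneg _) hqt 2
  have hdot := mul_norm_sq_le_of_norm_le (r := dotαL m.α X.p) hinv
    (inv_le_div_of_le_mul hμ hlam hμlam) hpt
  have hconst : cLam / m.μ * (Real.sqrt (2 * m.μ) / β) ^ 2 = 2 * cLam / β ^ 2 := by
    rw [div_pow, Real.sq_sqrt (by positivity)]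
    field_simp
  have hrest : 0 ≤ (1 + 4 * cLam) / β ^ 2
      * (‖storageMap s X.p‖ ^ 2 + lam⁻¹ * ‖X.pt - dotαL m.α X.p‖ ^ 2) := by positivity
  have hpos : 0 ≤ ‖storageMap s X.p‖ ^ 2 + ‖strainMap m.μ X.u‖ ^ 2 := by positivity
  rw [hconst] at hdot
  have hnorm : X.normSq s lam = ‖strainMap m.μ X.u‖ ^ 2 + qtNorm m.μ X.pt ^ 2
      + (‖storageMap s X.p‖ ^ 2 + lam⁻¹ * ‖dotαL m.α X.p‖ ^ 2) := by
    simp only [State.normSq, vNorm_eq_norm hμ.le, sNorm_sq hs hlam.le]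
  linear_combination hnorm + hqt_sq + hdot + hrest + hpos

lemma defect_terms_le {E H : Type*} [SeminormedAddCommGroup E] [NormedSpace ℝ E]
    [SeminormedAddCommGroup H] [NormedSpace ℝ H] (L : E →L[ℝ] H) {a θ : E} {ψ : H} {l k Λ : ℝ}
    (hl : 0 ≤ l) (hlΛ : l ≤ Λ) (ha : ‖a‖ ≤ δ) (hθ : ‖θ‖ ≤ δ) (hψ : ‖ψ‖ ≤ δ) :
    l ^ 2 * k ^ 2 * ‖L a + (ψ - L θ)‖ ^ 2 + l * ‖ψ - L θ‖ ^ 2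
      ≤ (Λ ^ 2 * k ^ 2 * (1 + 2 * ‖L‖) ^ 2 + Λ * (1 + ‖L‖) ^ 2) * δ ^ 2 := by
  have hΛ : 0 ≤ Λ := hl.trans hlΛ
  have hcoupled : ‖ψ - L θ‖ ≤ (1 + ‖L‖) * δ := by
    linarith [norm_sub_le ψ (L θ), L.le_opNorm_of_le hθ]
  have hsum : ‖L a + (ψ - L θ)‖ ≤ (1 + 2 * ‖L‖) * δ := by
    linarith [norm_add_le (L a) (ψ - L θ), L.le_opNorm_of_le ha]
  calc l ^ 2 * k ^ 2 * ‖L a + (ψ - L θ)‖ ^ 2 + l * ‖ψ - L θ‖ ^ 2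
      ≤ Λ ^ 2 * k ^ 2 * ((1 + 2 * ‖L‖) * δ) ^ 2 + Λ * ((1 + ‖L‖) * δ) ^ 2 := by gcongr
    _ = _ := by ring

/-- The constant in the stability estimate of the step, see
`IsSolution.normSq_step_error_le`. -/
def Medium.stepConst (m : Medium d N) (sMax cLam β : ℝ) : ℝ :=
  (2 + (1 + 4 * cLam) / β ^ 2)
    * ((cLam / m.μ) ^ 2 * (Real.sqrt (2 * m.μ) / β) ^ 2
        * (1 + 2 * ‖dotαL (Ω := m.Ω) m.α‖) ^ 2
      + cLam / m.μ * (1 + ‖dotαL (Ω := m.Ω) m.α‖) ^ 2 + N * sMax)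

lemma Medium.stepConst_nonneg (hμ : 0 ≤ m.μ) (hsMax : 0 ≤ sMax) (hcLam : 0 ≤ cLam) :
    0 ≤ m.stepConst sMax cLam β := by
  rw [Medium.stepConst]
  positivity

lemma IsSolution.normSq_step_error_le (hs : IsSolution m s lam T f g u0 pt0 p0 u pt p)
    (hr : IsRegular ku kp T M u pt p) (hm : m.HasBoundedCoefficients)
    (hsMax : ∀ i, 0 ≤ s i ∧ s i ≤ sMax) (hsMax0 : 0 ≤ sMax) (hlam : 0 < lam)
    (hμlam : m.μ ≤ cLam * lam)
    (hcLam : 0 ≤ cLam) (hβ : 0 < β) (hcStab : 0 < cStab) (hτ : 0 < τ) (hτT : τ ≤ T)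
    (hg : ContinuousOn g (Icc 0 T)) (hD : D.Admissible ku kp β cStab cApp h)
    (hP0 : D.IsProjection lam (stateAt u pt p 0) P0)
    (hP1 : D.IsProjection lam (stateAt u pt p τ) P1) (hp : X0h.p = P0.p)
    (hX : D.IsMonolithicStep s lam τ (f τ) (g 0) (g τ) X0h X1h)
    (helliptic : ‖(stateAt u pt p τ).p - P1.p‖ ≤ δ) (hθ : ‖networkDefect T τ p P0 P1‖ ≤ δ)
    (hψ : ‖totalDefect T τ pt P1 X0h‖ ≤ δ) :
    (P1 - X1h).normSq s lam + τ * D.aNorm (P1 - X1h).p ^ 2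
      ≤ m.stepConst sMax cLam β * δ ^ 2 := by
  have hμ := hm.μ_pos
  have hs0 (i : Fin N) : 0 ≤ s i := (hsMax i).1
  have hS : SolvesStokes m lam (f τ) (stateAt u pt p τ).u (stateAt u pt p τ).pt
      (stateAt u pt p τ).p := hs.stokes τ ⟨hτ, hτT⟩
  have hnorm : (P1 - X1h).normSq s lam ≤ _ := State.normSq_le_energy hs0 hμ hlam hμlam hcLam
    (hS.norm_totalPressure_error_le hμ hβ hD hP1 hX)
  have henergy := hs.step_error_energy_le hr hm hs0 hlam.le hβ hτ hτT hg hD hP0 hP1 hp hX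
  have hdefect := defect_terms_le (dotαL m.α) (k := Real.sqrt (2 * m.μ) / β) (inv_nonneg.2 hlam.le)
    (inv_le_div_of_le_mul hμ hlam hμlam) helliptic hθ hψ
  have hstorage : ‖storageMap s (networkDefect T τ p P0 P1)‖ ^ 2 ≤ N * sMax * δ ^ 2 :=
    (norm_storageMap_sq_le hsMax _).trans (by gcongr)
  have hA : 0 ≤ D.aForm (P1.p - X1h.p) (P1.p - X1h.p) :=
    Discretization.aForm_self_nonneg hm hcStab hD
      (sub_mem hP1.mem.p_mem_pressureSpace hX.mem.p_mem_pressureSpace)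
  have haNorm : D.aNorm (P1 - X1h).p ^ 2 = D.aForm (P1.p - X1h.p) (P1.p - X1h.p) := Real.sq_sqrt hA
  have hc : 0 ≤ 1 + (1 + 4 * cLam) / β ^ 2 := by positivity
  have htotal := mul_le_mul_of_nonneg_left (henergy.trans (add_le_add hdefect hstorage))
    (show 0 ≤ 2 + (1 + 4 * cLam) / β ^ 2 by positivity)
  rw [haNorm, Medium.stepConst]
  have hdissipation := mul_nonneg hc (mul_nonneg hτ.le hA)
  linear_combination hnorm + htotal + hdissipation

end errorBounds

section defectBounds

variable {d N : ℕ} {m : Medium d N} {D : Discretization m} {s : Fin N → ℝ}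
  {lam cLam T M τ ρ ρ' η : ℝ} {ku kp : ℕ} {β cStab cApp cInit h : ℝ}
  {f : ℝ → Fin d → L2 m.Ω} {g : ℝ → Fin N → L2 m.Ω} {u0 : Fin d → H1 m.Ω} {pt0 : L2 m.Ω}
  {p0 : Fin N → H1 m.Ω} {u : ℝ → Fin d → H1 m.Ω} {pt : ℝ → L2 m.Ω} {p : ℝ → Fin N → H1 m.Ω}
  {P0 P1 X0h : State m}

lemma norm_trapezoid_sub_increment_le {E : Type*} [NormedAddCommGroup E] [NormedSpace ℝ E]
    {F : ℝ → E} {y0 y1 : E} (hT : 0 < T) (hτ : τ ∈ Icc 0 T) (hF : ContDiffOn ℝ 3 F (Icc 0 T))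
    (hM : ∀ t ∈ Icc 0 T, ‖iteratedDerivWithin 3 F (Icc 0 T) t‖ ≤ M)
    (h0 : ‖F 0 - y0‖ ≤ ρ) (h1 : ‖F τ - y1‖ ≤ ρ') :
    ‖trapezoid 0 T τ F - (y1 - y0)‖ ≤ M * τ ^ 3 + ρ + ρ' := by
  have htrapezoid := norm_trapezoid_sub_le hT hτ hF hM
  rw [sub_zero] at htrapezoid
  have hsplit : trapezoid 0 T τ F - (y1 - y0)
      = trapezoid 0 T τ F - (F τ - F 0) + ((F τ - y1) - (F 0 - y0)) := by abel
  rw [hsplit]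
  linarith [norm_add_le (trapezoid 0 T τ F - (F τ - F 0)) ((F τ - y1) - (F 0 - y0)),
    norm_sub_le (F τ - y1) (F 0 - y0)]

lemma IsRegular.norm_networkDefect_le (hr : IsRegular ku kp T M u pt p) (hT : 0 < T)
    (hτ : τ ∈ Icc 0 T) (h0 : ‖(stateAt u pt p 0).p - P0.p‖ ≤ ρ)
    (h1 : ‖(stateAt u pt p τ).p - P1.p‖ ≤ ρ) :
    ‖networkDefect T τ p P0 P1‖ ≤ M * τ ^ 3 + ρ + ρ := by
  have hM : 0 ≤ M := (norm_nonneg _).trans (hr.pt_deriv_le 3 le_rfl τ hτ)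
  have hρ : 0 ≤ ρ := (norm_nonneg _).trans h0
  have hτ0 : 0 ≤ τ := hτ.1
  rw [pi_norm_le_iff_of_nonneg (by positivity)]
  exact fun i => norm_trapezoid_sub_increment_le hT hτ (hr.p_smooth i) (hr.p_deriv_le i 3 le_rfl)
    ((norm_le_pi_norm _ i).trans h0) ((norm_le_pi_norm _ i).trans h1)

lemma IsRegular.norm_totalDefect_le (hr : IsRegular ku kp T M u pt p) (hT : 0 < T)
    (hτ : τ ∈ Icc 0 T) (h0 : ‖pt 0 - X0h.pt‖ ≤ ρ) (h1 : ‖pt τ - P1.pt‖ ≤ ρ') :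
    ‖totalDefect T τ pt P1 X0h‖ ≤ M * τ ^ 3 + ρ + ρ' :=
  norm_trapezoid_sub_increment_le hT hτ hr.pt_smooth (hr.pt_deriv_le 3 le_rfl) h0 h1

lemma Discretization.IsInitial.error_le (hX : D.IsInitial ku cInit h (stateAt u pt p 0) P0 X0h)
    (hr : IsRegular ku kp T M u pt p) (hT : 0 ≤ T) (hcInit : 0 ≤ cInit) (hh : 0 ≤ h) :
    vNorm m.μ ((stateAt u pt p 0).u - X0h.u) ≤ 2 * cInit * M * h ^ ku ∧
      qtNorm m.μ ((stateAt u pt p 0).pt - X0h.pt) ≤ 2 * cInit * M * h ^ ku := by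
  have h0 : (0 : ℝ) ∈ Icc 0 T := left_mem_Icc.2 hT
  have hnorms := mul_le_mul_of_nonneg_left (add_le_add (hr.u_le 0 h0) (hr.pt_le 0 h0))
    (show 0 ≤ cInit * h ^ ku by positivity)
  have hsum : vNorm m.μ ((stateAt u pt p 0).u - X0h.u)
      + qtNorm m.μ ((stateAt u pt p 0).pt - X0h.pt) ≤ 2 * cInit * M * h ^ ku :=
    (hX.bound.trans hnorms).trans_eq (by ring)
  exact ⟨(le_add_of_nonneg_right (Real.sqrt_nonneg _)).trans hsum,
    (le_add_of_nonneg_left (Real.sqrt_nonneg _)).trans hsum⟩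

end defectBounds

section convergence

variable {d N : ℕ} {m : Medium d N} {D : Discretization m} {s : Fin N → ℝ}
  {lam sMax cLam T M τ η : ℝ} {ku kp : ℕ} {β cStab cApp cInit h : ℝ}
  {f : ℝ → Fin d → L2 m.Ω} {g : ℝ → Fin N → L2 m.Ω} {u0 : Fin d → H1 m.Ω} {pt0 : L2 m.Ω}
  {p0 : Fin N → H1 m.Ω} {u : ℝ → Fin d → H1 m.Ω} {pt : ℝ → L2 m.Ω} {p : ℝ → Fin N → H1 m.Ω}
  {P0 P1 X0h X1h : State m}

/-- The constant in the bounds for the defects of the step, see `IsSolution.defects_le`. -/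
def Medium.HasBoundedCoefficients.defectConst (hm : m.HasBoundedCoefficients)
    (cLam β cStab cApp cInit M : ℝ) : ℝ :=
  M + 2 * (hm.ellipticConst cStab * (2 * cApp * M)) + m.lameConst cLam β * (2 * cApp * M)
    + Real.sqrt (2 * m.μ) * (2 * cInit * M)

lemma IsSolution.defects_le (hs : IsSolution m s lam T f g u0 pt0 p0 u pt p)
    (hr : IsRegular ku kp T M u pt p) (hm : m.HasBoundedCoefficients) (hlam : 0 < lam)
    (hμlam : m.μ ≤ cLam * lam) (hcLam : 0 < cLam) (hβ : 0 < β) (hcStab : 0 < cStab)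
    (hcApp : 0 < cApp) (hcInit : 0 < cInit) (hM : 0 < M) (hh : 0 < h) (hτ : 0 < τ) (hτT : τ ≤ T)
    (hg : ContinuousOn g (Icc 0 T)) (hD : D.Admissible ku kp β cStab cApp h)
    (hP0 : D.IsProjection lam (stateAt u pt p 0) P0)
    (hP1 : D.IsProjection lam (stateAt u pt p τ) P1)
    (hX : D.IsInitial ku cInit h (stateAt u pt p 0) P0 X0h)
    (hτη : τ ^ 3 ≤ η) (hkp : h ^ kp ≤ η) (hku : h ^ ku ≤ η) :
    ‖(stateAt u pt p τ).p - P1.p‖ ≤ hm.defectConst cLam β cStab cApp cInit M * η ∧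
      ‖networkDefect T τ p P0 P1‖ ≤ hm.defectConst cLam β cStab cApp cInit M * η ∧
      ‖totalDefect T τ pt P1 X0h‖ ≤ hm.defectConst cLam β cStab cApp cInit M * η := by
  have hμ := hm.μ_pos
  have hT : 0 < T := hτ.trans_le hτT
  have hτ_mem : τ ∈ Icc 0 T := ⟨hτ.le, hτT⟩
  have h0_mem : (0 : ℝ) ∈ Icc 0 T := left_mem_Icc.2 hT.le
  have helliptic0 := hs.ellipticProjection_error_le hr hm hT hg h0_mem hcStab hcApp hM hh hD hP0
  have helliptic1 := hs.ellipticProjection_error_le hr hm hT hg hτ_mem hcStab hcApp hM hh hD hP1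
  have hlame1 := (hr.lameProjection_error_le (hs.u_mem τ hτ_mem) hτ_mem hμ hlam hμlam hβ hcApp hM
    hh hD hP1).2
  have hinit : ‖(stateAt u pt p 0).pt - X0h.pt‖
      ≤ Real.sqrt (2 * m.μ) * (2 * cInit * M * h ^ ku) := by
    rw [norm_eq_qtNorm hμ]
    gcongr
    exact (hX.error_le hr hT.le hcInit.le hh.le).2
  have hnetwork := hr.norm_networkDefect_le hT hτ_mem helliptic0 helliptic1
  have htotal := hr.norm_totalDefect_le hT hτ_mem hinit hlame1
  have hη : 0 ≤ η := (by positivity : (0 : ℝ) ≤ τ ^ 3).trans hτη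
  have hell := mul_nonneg (hm.ellipticConst_nonneg hcStab.le) (by positivity : 0 ≤ 2 * cApp * M)
  have hlame := mul_nonneg (Medium.lameConst_nonneg (m := m) hμ.le hcLam.le hβ.le)
    (by positivity : 0 ≤ 2 * cApp * M)
  have hini : 0 ≤ Real.sqrt (2 * m.μ) * (2 * cInit * M) := by positivity
  have hMη := mul_le_mul_of_nonneg_left hτη hM.le
  have hellη := mul_le_mul_of_nonneg_left hkp hell
  have hlameη := mul_le_mul_of_nonneg_left hku hlame
  have hiniη := mul_le_mul_of_nonneg_left hku hini
  have hM_nonneg := mul_nonneg hM.le hη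
  have hell_nonneg := mul_nonneg hell hη
  have hlame_nonneg := mul_nonneg hlame hη
  have hini_nonneg := mul_nonneg hini hη
  unfold Medium.HasBoundedCoefficients.defectConst
  refine ⟨helliptic1.trans ?_, hnetwork.trans ?_, htotal.trans ?_⟩ <;> linarith

lemma IsSolution.normSq_discrete_error_le (hs : IsSolution m s lam T f g u0 pt0 p0 u pt p)
    (hr : IsRegular ku kp T M u pt p) (hm : m.HasBoundedCoefficients)
    (hsMax : ∀ i, 0 ≤ s i ∧ s i ≤ sMax) (hsMax0 : 0 ≤ sMax) (hlam : 0 < lam)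
    (hμlam : m.μ ≤ cLam * lam) (hcLam : 0 < cLam) (hβ : 0 < β) (hcStab : 0 < cStab)
    (hcApp : 0 < cApp) (hcInit : 0 < cInit) (hM : 0 < M) (hh : 0 < h) (hτ : 0 < τ) (hτT : τ ≤ T)
    (hg : ContinuousOn g (Icc 0 T)) (hD : D.Admissible ku kp β cStab cApp h)
    (hP0 : D.IsProjection lam (stateAt u pt p 0) P0)
    (hP1 : D.IsProjection lam (stateAt u pt p τ) P1)
    (hX0 : D.IsInitial ku cInit h (stateAt u pt p 0) P0 X0h)
    (hX1 : D.IsMonolithicStep s lam τ (f τ) (g 0) (g τ) X0h X1h) :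
    (P1 - X1h).normSq s lam + τ * D.aNorm (P1 - X1h).p ^ 2
      ≤ m.stepConst sMax cLam β * hm.defectConst cLam β cStab cApp cInit M ^ 2
        * (τ ^ 3 + h ^ kp + h ^ ku) ^ 2 := by
  have hnonneg : 0 ≤ τ ^ 3 ∧ 0 ≤ h ^ kp ∧ 0 ≤ h ^ ku := by
    refine ⟨?_, ?_, ?_⟩ <;> positivity
  obtain ⟨helliptic, hnetwork, htotal⟩ := hs.defects_le hr hm hlam hμlam hcLam hβ hcStab hcApp
    hcInit hM hh hτ hτT hg hD hP0 hP1 hX0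
    (η := τ ^ 3 + h ^ kp + h ^ ku) (by linarith) (by linarith) (by linarith)
  rw [mul_assoc, ← mul_pow]
  exact hs.normSq_step_error_le hr hm hsMax hsMax0 hlam hμlam hcLam.le hβ hcStab hτ hτT hg hD hP0
    hP1 hX0.p_eq hX1 helliptic hnetwork htotal

/-- The constant in the bound for the discrete error at time `0`, see
`IsSolution.normSq_initial_error_le`. -/
def Medium.initialConst (m : Medium d N) (cLam β cApp cInit M : ℝ) : ℝ :=
  2 * cInit * M + (1 + (Real.sqrt (2 * m.μ))⁻¹) * (m.lameConst cLam β * (2 * cApp * M))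

lemma IsSolution.initial_error_le (hs : IsSolution m s lam T f g u0 pt0 p0 u pt p)
    (hr : IsRegular ku kp T M u pt p) (hT : 0 ≤ T) (hμ : 0 < m.μ) (hlam : 0 < lam)
    (hμlam : m.μ ≤ cLam * lam) (hcLam : 0 < cLam) (hβ : 0 < β)
    (hcApp : 0 < cApp) (hcInit : 0 < cInit) (hM : 0 < M) (hh : 0 < h)
    (hD : D.Admissible ku kp β cStab cApp h) (hP0 : D.IsProjection lam (stateAt u pt p 0) P0)
    (hX : D.IsInitial ku cInit h (stateAt u pt p 0) P0 X0h) :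
    vNorm m.μ (P0 - X0h).u ≤ m.initialConst cLam β cApp cInit M * h ^ ku ∧
      qtNorm m.μ (P0 - X0h).pt ≤ m.initialConst cLam β cApp cInit M * h ^ ku := by
  have h0_mem : (0 : ℝ) ∈ Icc 0 T := left_mem_Icc.2 hT
  obtain ⟨hlame_u, hlame_pt⟩ := hr.lameProjection_error_le (hs.u_mem 0 h0_mem) h0_mem hμ hlam hμlam
    hβ hcApp hM hh hD hP0
  obtain ⟨hinit_u, hinit_pt⟩ := hX.error_le hr hT hcInit.le hh.le
  rw [← vNorm_eq_norm hμ.le] at hlame_u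
  have hlame_qt : qtNorm m.μ ((stateAt u pt p 0).pt - P0.pt)
      ≤ (Real.sqrt (2 * m.μ))⁻¹ * (m.lameConst cLam β * (2 * cApp * M * h ^ ku)) := by
    rw [qtNorm_eq]
    gcongr
  have hlame_nonneg := mul_nonneg (Medium.lameConst_nonneg (m := m) hμ.le hcLam.le hβ.le)
    (by positivity : 0 ≤ 2 * cApp * M * h ^ ku)
  have hlame_qt_nonneg := mul_nonneg (inv_nonneg.2 (Real.sqrt_nonneg (2 * m.μ))) hlame_nonneg
  have hu_triangle := vNorm_sub_le hμ.le ((stateAt u pt p 0).u - X0h.u)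
    ((stateAt u pt p 0).u - P0.u)
  have hpt_triangle := qtNorm_sub_le (μ := m.μ) ((stateAt u pt p 0).pt - X0h.pt)
    ((stateAt u pt p 0).pt - P0.pt)
  rw [sub_sub_sub_cancel_left] at hu_triangle hpt_triangle
  unfold Medium.initialConst
  exact ⟨hu_triangle.trans (by linarith), hpt_triangle.trans (by linarith)⟩

lemma IsSolution.normSq_initial_error_le (hs : IsSolution m s lam T f g u0 pt0 p0 u pt p)
    (hr : IsRegular ku kp T M u pt p) (hT : 0 ≤ T) (hμ : 0 < m.μ) (hlam : 0 < lam)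
    (hμlam : m.μ ≤ cLam * lam) (hcLam : 0 < cLam) (hβ : 0 < β)
    (hcApp : 0 < cApp) (hcInit : 0 < cInit) (hM : 0 < M) (hh : 0 < h)
    (hD : D.Admissible ku kp β cStab cApp h) (hP0 : D.IsProjection lam (stateAt u pt p 0) P0)
    (hX : D.IsInitial ku cInit h (stateAt u pt p 0) P0 X0h) :
    (P0 - X0h).normSq s lam
      ≤ 2 * m.initialConst cLam β cApp cInit M ^ 2 * (h ^ ku) ^ 2 := by
  obtain ⟨hu, hpt⟩ := hs.initial_error_le hr hT hμ hlam hμlam hcLam hβ hcApp hcInit hM hh hD hP0 hX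
  have hu_sq : vNorm m.μ (P0 - X0h).u ^ 2 ≤ (m.initialConst cLam β cApp cInit M * h ^ ku) ^ 2 :=
    pow_le_pow_left₀ (Real.sqrt_nonneg _) hu 2
  have hpt_sq : qtNorm m.μ (P0 - X0h).pt ^ 2 ≤ (m.initialConst cLam β cApp cInit M * h ^ ku) ^ 2 :=
    pow_le_pow_left₀ (Real.sqrt_nonneg _) hpt 2
  have hp : sNorm s m.α lam (P0 - X0h).p = 0 := by
    rw [show (P0 - X0h).p = 0 from sub_eq_zero.2 hX.p_eq.symm]
    simp [sNorm, sForm, dotα]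
  rw [State.normSq, hp]
  linarith

lemma sq_add_pow_add_pow_le (τ h : ℝ) (kp ku : ℕ) :
    (τ ^ 3 + h ^ kp + h ^ ku) ^ 2 ≤ 3 * (τ ^ 6 + h ^ (2 * kp) + h ^ (2 * ku)) := by
  rw [pow_mul', pow_mul', show τ ^ 6 = (τ ^ 3) ^ 2 by ring]
  linarith [sq_nonneg (τ ^ 3 - h ^ kp), sq_nonneg (h ^ kp - h ^ ku), sq_nonneg (τ ^ 3 - h ^ ku)]

lemma State.normSq_sub_add_le {X Y : State m} {c₁ c₀ a ζ : ℝ} (hμ : 0 ≤ m.μ) (hs : ∀ i, 0 ≤ s i)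
    (hlam : 0 ≤ lam) (hc₁ : 0 ≤ c₁) (hc₀ : 0 ≤ c₀) (ha : 0 ≤ a)
    (hX : X.normSq s lam + a ≤ c₁ * η ^ 2) (hY : Y.normSq s lam ≤ c₀ * η ^ 2)
    (hη : η ^ 2 ≤ 3 * ζ) : (X - Y).normSq s lam + a ≤ 6 * (1 + c₁ + c₀) * ζ := by
  calc (X - Y).normSq s lam + a ≤ 2 * X.normSq s lam + 2 * Y.normSq s lam + a := by
        gcongr
        exact State.normSq_sub_le hμ hs hlam
    _ ≤ 2 * (c₁ + c₀) * η ^ 2 := by linarith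
    _ ≤ 2 * (1 + c₁ + c₀) * (3 * ζ) := by
        gcongr
        linarith
    _ = 6 * (1 + c₁ + c₀) * ζ := by ring

end convergence

end MPET

end

theorem mainTheorem3_general {d N : ℕ} (m : MPET.Medium d N) (hm : m.HasBoundedCoefficients)
    (T : ℝ) (ku kp : ℕ) (sMax cLam β cStab cApp cInit M : ℝ)
    (hsMax : 0 ≤ sMax) (hcLam : 0 < cLam) (hβ : 0 < β) (hcStab : 0 < cStab) (hcApp : 0 < cApp)
    (hcInit : 0 < cInit) (hM : 0 < M) :
    ∃ C : ℝ, 0 < C ∧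
      ∀ (s : Fin N → ℝ) (lam : ℝ), (∀ i, 0 ≤ s i ∧ s i ≤ sMax) → 0 < lam → m.μ ≤ cLam * lam →
      ∀ (f : ℝ → Fin d → MPET.L2 m.Ω) (g : ℝ → Fin N → MPET.L2 m.Ω),
        ContinuousOn g (Set.Icc 0 T) →
      ∀ (u0 : Fin d → MPET.H1 m.Ω) (pt0 : MPET.L2 m.Ω) (p0 : Fin N → MPET.H1 m.Ω)
        (u : ℝ → Fin d → MPET.H1 m.Ω) (pt : ℝ → MPET.L2 m.Ω) (p : ℝ → Fin N → MPET.H1 m.Ω),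
        MPET.IsSolution m s lam T f g u0 pt0 p0 u pt p →
        MPET.IsRegular ku kp T M u pt p →
      ∀ (h Δt : ℝ), 0 < h → 0 < Δt → Δt ≤ T →
      ∀ D : MPET.Discretization m, D.Admissible ku kp β cStab cApp h →
      ∀ P0 P1 X0h X1h : MPET.State m,
        D.IsProjection lam (MPET.stateAt u pt p 0) P0 →
        D.IsProjection lam (MPET.stateAt u pt p Δt) P1 →
        D.IsInitial ku cInit h (MPET.stateAt u pt p 0) P0 X0h →
        D.IsMonolithicStep s lam Δt (f Δt) (g 0) (g Δt) X0h X1h →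
      MPET.vNorm m.μ ((P1 - X1h) - (P0 - X0h)).u ^ 2
          + MPET.qtNorm m.μ ((P1 - X1h) - (P0 - X0h)).pt ^ 2
          + MPET.sNorm s m.α lam ((P1 - X1h) - (P0 - X0h)).p ^ 2
          + Δt * D.aNorm (P1 - X1h).p ^ 2
        ≤ C * (Δt ^ 6 + h ^ (2 * kp) + h ^ (2 * ku)) ∧
      MPET.vNorm m.μ (P1 - X1h).u + MPET.qtNorm m.μ (P1 - X1h).pt
          + MPET.sNorm s m.α lam (P1 - X1h).p
        ≤ C * (Δt ^ 3 + h ^ kp + h ^ ku) := by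
  set C₁ := m.stepConst sMax cLam β * hm.defectConst cLam β cStab cApp cInit M ^ 2
  set C₀ := 2 * m.initialConst cLam β cApp cInit M ^ 2
  have hμ := hm.μ_pos
  have hC₁ : 0 ≤ C₁ :=
    mul_nonneg (MPET.Medium.stepConst_nonneg hμ.le hsMax hcLam.le) (sq_nonneg _)
  have hC₀ : 0 ≤ C₀ := by positivity
  refine ⟨6 * (1 + C₁ + C₀), by positivity, ?_⟩
  intro s lam hs hlam hμlam f g hg u0 pt0 p0 u pt p hsol hreg h Δt hh hΔt hΔtT D hD P0 P1 X0h X1h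
    hP0 hP1 hX0 hX1
  have hη : 0 ≤ Δt ^ 3 + h ^ kp + h ^ ku := by positivity
  have hstep := hsol.normSq_discrete_error_le hreg hm hs hsMax hlam hμlam hcLam hβ hcStab hcApp
    hcInit hM hh hΔt hΔtT hg hD hP0 hP1 hX0 hX1
  have hinit := hsol.normSq_initial_error_le (s := s) hreg (hΔt.le.trans hΔtT) hμ hlam hμlam hcLam
    hβ hcApp hcInit hM hh hD hP0 hX0
  have hdissipation : 0 ≤ Δt * D.aNorm (P1 - X1h).p ^ 2 := by positivity
  exact ⟨MPET.State.normSq_sub_add_le hμ.le (fun i => (hs i).1) hlam.le hC₁ hC₀ hdissipation hstep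
      (hinit.trans (by gcongr; exact le_add_of_nonneg_left (by positivity)))
      (MPET.sq_add_pow_add_pow_le Δt h kp ku),
    (MPET.State.norm_add_norm_add_norm_le hC₁ hη
      ((le_add_of_nonneg_right hdissipation).trans hstep)).trans
        (mul_le_mul_of_nonneg_right (by linarith) hη)⟩

theorem mainTheorem3 {d N : ℕ} (m : MPET.Medium d N) (hm : m.Admissible)
    (T : ℝ) (hT : 0 < T) (ku kp : ℕ) (hku : 1 ≤ ku) (hkp : 1 ≤ kp)
    (sMax cLam β cStab cApp cInit M : ℝ)
    (hsMax : 0 < sMax) (hcLam : 0 < cLam) (hβ : 0 < β) (hcStab : 0 < cStab) (hcApp : 0 < cApp)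
    (hcInit : 0 < cInit) (hM : 0 < M) :
    ∃ C : ℝ, 0 < C ∧
      ∀ (s : Fin N → ℝ) (lam : ℝ), (∀ i, 0 < s i ∧ s i ≤ sMax) → 0 < lam → m.μ ≤ cLam * lam →
      ∀ (f : ℝ → Fin d → MPET.L2 m.Ω) (g : ℝ → Fin N → MPET.L2 m.Ω),
        ContinuousOn f (Set.Icc 0 T) → ContinuousOn g (Set.Icc 0 T) →
      ∀ (u0 : Fin d → MPET.H1 m.Ω) (pt0 : MPET.L2 m.Ω) (p0 : Fin N → MPET.H1 m.Ω),
        MPET.IsCompatible m lam (f 0) u0 pt0 p0 →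
      ∀ (u : ℝ → Fin d → MPET.H1 m.Ω) (pt : ℝ → MPET.L2 m.Ω) (p : ℝ → Fin N → MPET.H1 m.Ω),
        MPET.IsSolution m s lam T f g u0 pt0 p0 u pt p →
        MPET.IsRegular ku kp T M u pt p →
      ∀ (h Δt : ℝ), 0 < h → 0 < Δt → Δt ≤ T →
      ∀ D : MPET.Discretization m, D.Admissible ku kp β cStab cApp h →
      ∀ P0 P1 X0h X1h : MPET.State m,
        D.IsProjection lam (MPET.stateAt u pt p 0) P0 →
        D.IsProjection lam (MPET.stateAt u pt p Δt) P1 →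
        D.IsInitial ku cInit h (MPET.stateAt u pt p 0) P0 X0h →
        D.IsMonolithicStep s lam Δt (f Δt) (g 0) (g Δt) X0h X1h →
      -- `P0 - X0h` and `P1 - X1h` are the discrete errors at the times `0` and `Δt`
      MPET.vNorm m.μ ((P1 - X1h) - (P0 - X0h)).u ^ 2
          + MPET.qtNorm m.μ ((P1 - X1h) - (P0 - X0h)).pt ^ 2
          + MPET.sNorm s m.α lam ((P1 - X1h) - (P0 - X0h)).p ^ 2
          + Δt * D.aNorm (P1 - X1h).p ^ 2
        ≤ C * (Δt ^ 6 + h ^ (2 * kp) + h ^ (2 * ku)) ∧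
      MPET.vNorm m.μ (P1 - X1h).u + MPET.qtNorm m.μ (P1 - X1h).pt
          + MPET.sNorm s m.α lam (P1 - X1h).p
        ≤ C * (Δt ^ 3 + h ^ kp + h ^ ku) := by
  obtain ⟨C, hC, hbound⟩ := mainTheorem3_general m hm.hasBoundedCoefficients T ku kp sMax cLam β
    cStab cApp cInit M hsMax.le hcLam hβ hcStab hcApp hcInit hM
  exact ⟨C, hC, fun s lam hs hlam hμlam f g _ hg u0 pt0 p0 _ u pt p => hbound s lam
    (fun i => ⟨(hs i).1.le, (hs i).2⟩) hlam hμlam f g hg u0 pt0 p0 u pt p⟩
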